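/- Let $k$ be an algebraically closed field of characteristic $0$, let $X$ be a smooth projective three-fold over $k$ (an integral closed subscheme of some $\mathbb{P}^n_k$, smooth of relative dimension $3$ over $k$), and let $R$ be a discrete valuation ring containing $k$, with uniformiser $\pi$ ($R$ need not be complete). Put $X_R = X\otimes_k R$ and, for an integer $m\ge 1$, $X_m = X\otimes_k R/\pi^m$, with closed immersion $\iota_m : X_m\hookrightarrow X_R$. For a Noetherian scheme $Y$ let $D(Y)$ be the unbounded derived category of the abelian category $\mathrm{Coh}(Y)$ of coherent sheaves on $Y$. Let $\iota_{m*}: D(X_m)\to D(X_R)$ be the functor induced by the exact functor $\iota_{m*}:\mathrm{Coh}(X_m)\to\mathrm{Coh}(X_R)$, and let $L\iota_m^* : D(X_R)\to D(X_m)$ be the total left derived functor of $\iota_m^*:\mathrm{Coh}(X_R)\to \mathrm{Coh}(X_m)$. Let $\mathrm{Coh}_{\le 1}(X_m)$ be the category of coherent sheaves on $X_m$ whose support has dimension at most $1$, let $\mathrm{Coh}_{\ge 2}(X_m)$ be the category of coherent sheaves $E$ on $X_m$ with $\mathrm{Hom}(G,E)=0$ for all $G\in \mathrm{Coh}_{\le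 1}(X_m)$, and let $\mathcal{A}^p_m = \langle \mathrm{Coh}_{\le 1}(X_m), \mathrm{Coh}_{\ge 2}(X_m)[1]\rangle$ be the full subcategory of $D(X_m)$ of the objects $F$ with $H^0(F)\in \mathrm{Coh}_{\le 1}(X_m)$, $H^{-1}(F)\in\mathrm{Coh}_{\ge 2}(X_m)$ and $H^i(F)=0$ for $i\ne 0,-1$. Then the left derived functor $L\iota_m^*$ exists, and for every object $F$ of $\mathcal{A}^p_m$ there is an exact triangle in $D(X_m)$ $$F[1]\longrightarrow L\iota_m^*\,\iota_{m*}F\longrightarrow F\longrightarrow F[2].$$ -/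

import Mathlib

open CategoryTheory CategoryTheory.Limits AlgebraicGeometry TopologicalSpace Opposite

universe u w

namespace PTHeart

/-- restriction from `U` to `W` behaves like localization at `a` -/
def LocSec {X : Scheme.{u}} (M : X.Modules) {U W : X.Opens} (h : W ≤ U) (a : Γ(X, U)) : Prop :=
  (∀ s : Γ(M, W), ∃ (n : ℕ) (t : Γ(M, U)),
    M.presheaf.map (homOfLE h).op t = X.presheaf.map (homOfLE h).op (a ^ n) • s) ∧
  (∀ t : Γ(M, U), M.presheaf.map (homOfLE h).op t = 0 → ∃ n : ℕ, a ^ n • t = 0)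

theorem smul_pow_spec {R : CommRingCat.{u}} (M : (Spec R).Modules) (U : (Spec R).Opens) (f : R) (n : ℕ)
    (x : Γ(M, U)) : (((Spec R).presheaf.map U.leTop.op) ((Scheme.ΓSpecIso R).inv f ^ n)) • x = f ^ n • x := by
  rw [Scheme.Modules.smul_Spec_def, map_pow, map_pow, map_pow]

theorem isQuasicoherent_spec_iff {R : CommRingCat.{u}} (M : (Spec R).Modules) :
    M.IsQuasicoherent ↔ ∀ f : R, LocSec M
      (show (Spec R).basicOpen ((Scheme.ΓSpecIso R).inv f) ≤ ⊤ from le_top)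
      ((Scheme.ΓSpecIso R).inv f) := by
  rw [isQuasicoherent_iff_isIso_fromTildeΓ, isIso_fromTildeΓ_iff_isLocalizing]
  refine forall_congr' fun f => ?_
  have top (n : ℕ) (x : Γ(M, ⊤)) : ((Scheme.ΓSpecIso R).inv f) ^ n • x = f ^ n • x := by
    refine Eq.trans ?_ (smul_pow_spec M ⊤ f n x)
    congr
  have e : (Spec R).basicOpen ((Scheme.ΓSpecIso R).inv f) = PrimeSpectrum.basicOpen f :=
    basicOpen_eq_of_affine f
  generalize hW : (Spec R).basicOpen ((Scheme.ΓSpecIso R).inv f) = W at e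
  subst e
  clear hW
  constructor
  · intro h
    have h : IsLocalizedModule.Away f
      ((modulesSpecToSheaf.obj M).obj.map (PrimeSpectrum.basicOpen f).leTop.op).hom := h
    refine ⟨fun s => ?_, fun t ht => ?_⟩
    · obtain ⟨n, y, hy⟩ := h.surj _ _ s
      exact ⟨n, y, hy.symm.trans (smul_pow_spec M _ f n s).symm⟩
    · obtain ⟨⟨_, n, rfl⟩, hn⟩ := (IsLocalizedModule.eq_zero_iff (.powers f)
        ((modulesSpecToSheaf.obj M).obj.map (PrimeSpectrum.basicOpen f).leTop.op).hom).mp ht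
      exact ⟨n, (top n t).trans hn⟩
  · rintro ⟨h1, h2⟩
    refine IsLocalizedModule.Away.mk_of_addCommGroup ?_ ?_ ?_
    · exact Scheme.Modules.isUnit_algebraMap_end_of_le_basicOpen f le_rfl
    · intro x
      obtain ⟨n, t, ht⟩ := h1 x
      exact ⟨n, t, (smul_pow_spec M (PrimeSpectrum.basicOpen f) f n x).symm.trans ht.symm⟩
    · intro x hx
      obtain ⟨n, hn⟩ := h2 x hx
      exact ⟨n, (top n x).symm.trans hn⟩

theorem locSec_congr {X : Scheme.{u}} (M : X.Modules) {U U' W W' : X.Opens} (eU : U' = U)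
    (eW : W' = W) (h : W ≤ U) (h' : W' ≤ U') (a : Γ(X, U)) (a' : Γ(X, U'))
    (ha : a = X.presheaf.map (eqToHom eU.symm).op a') :
    LocSec M h a ↔ LocSec M h' a' := by
  subst eU eW
  have : a = a' := by simpa using ha
  rw [this]

theorem locSec_restrict {X Y : Scheme.{u}} (f : Y ⟶ X) [IsOpenImmersion f] (M : X.Modules)
    {U W : Y.Opens} (h : W ≤ U) (a : Γ(Y, U)) :
    LocSec (M.restrict f) h a ↔
      LocSec M (U := f ''ᵁ U) (W := f ''ᵁ W) (f.image_mono h) ((f.appIso U).inv a) := by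
  have key (a : Γ(Y, U)) : (f.appIso W).inv (Y.presheaf.map (homOfLE h).op a) =
      X.presheaf.map (homOfLE (f.image_mono h)).op ((f.appIso U).inv a) :=
    ConcreteCategory.congr_hom (f.appIso_inv_naturality (homOfLE h).op) a
  unfold LocSec
  refine and_congr (forall_congr' fun s => exists_congr fun n => exists_congr fun t => ?_)
    (forall_congr' fun s => imp_congr Iff.rfl (exists_congr fun n => ?_))
  · rw [← map_pow, ← key]; rfl
  · rw [← map_pow]; rfl

theorem isQuasicoherent_restrict_fromSpec_iff {X : Scheme.{u}} (M : X.Modules) {U : X.Opens}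
    (hU : IsAffineOpen U) :
    (M.restrict hU.fromSpec).IsQuasicoherent ↔
      ∀ a : Γ(X, U), LocSec M (X.basicOpen_le a) a := by
  rw [isQuasicoherent_spec_iff]
  refine forall_congr' fun a => ?_
  rw [locSec_restrict]
  symm
  refine locSec_congr M (by simp) ?_ _ _ _ _ ?_
  · rw [← hU.fromSpec_preimage_basicOpen', Scheme.Hom.image_preimage_eq_opensRange_inf,
      hU.opensRange_fromSpec]
    exact inf_eq_right.mpr (X.basicOpen_le a)
  · have h1 : (Scheme.ΓSpecIso Γ(X, U)).inv =
        hU.fromSpec.appLE U ⊤ hU.fromSpec_preimage_self.ge := by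
      rw [Scheme.Hom.appLE, hU.fromSpec_app_self, Category.assoc, ← Functor.map_comp,
        ← op_comp, Subsingleton.elim (_ ≫ _) (𝟙 _)]
      simp
    have h2 := ConcreteCategory.congr_hom (hU.fromSpec.appLE_appIso_inv
      hU.fromSpec_preimage_self.ge) a
    rw [← h1] at h2
    have h3 : (hU.fromSpec.appIso ⊤).inv ((Scheme.ΓSpecIso Γ(X, U)).inv a) = _ := h2
    rw [h3, ← ConcreteCategory.comp_apply, ← Functor.map_comp, ← op_comp,
      Subsingleton.elim (_ ≫ _) (𝟙 _)]
    simp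

/-- transport of a presentation along an isomorphism of `O_X`-modules -/
noncomputable def presentationOfIso {X : Scheme.{u}} {M N : X.Modules} (e : M ≅ N)
    (P : M.Presentation) : N.Presentation :=
  haveI : IsIso (C := SheafOfModules.{u} X.ringCatSheaf) e.hom :=
    ⟨e.inv, e.hom_inv_id, e.inv_hom_id⟩
  SheafOfModules.Presentation.ofIsIso (R := X.ringCatSheaf) e.hom P

theorem isQuasicoherent_of_cover {X : Scheme.{u}} (M : X.Modules) {ι : Type u}
    (U : ι → X.Opens) (hU : IsOpenCover U) (h : ∀ i, Nonempty (M.restrict (U i).ι).Presentation) :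
    M.IsQuasicoherent := by
  let q : SheafOfModules.QuasicoherentData.{u} (R := X.ringCatSheaf) M := {
    I := ι
    X := U
    coversTop := (Opens.coversTop_iff _ U).mpr hU
    presentation := fun i => by
      let e := Opens.sheafOfModulesEquivOver.{u} (U i) X.ringCatSheaf
      haveI : PreservesColimitsOfSize.{u, u} e.inverse :=
        e.symm.toAdjunction.leftAdjoint_preservesColimits
      have P : SheafOfModules.Presentation.{u} (R := (U i).sheafRestrict.obj X.ringCatSheaf)
        (M.restrict (U i).ι) := (h i).some
      have P' := P.map e.inverse
        (Opens.sheafOfModulesEquivOverInverseUnit (U i) X.ringCatSheaf).symm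
      have e' : e.inverse.obj (M.restrict (U i).ι) ≅
          SheafOfModules.over (R := X.ringCatSheaf) M (U i) :=
        (Scheme.Modules.overEquiv (U i)).inverse.mapIso
          ((Scheme.Modules.overFunctorEquiv (U i)).app M).symm ≪≫
          ((Scheme.Modules.overEquiv (U i)).unitIso.app
            (SheafOfModules.over (R := X.ringCatSheaf) M (U i))).symm
      exact P'.ofIsIso e'.hom
  }
  exact q.isQuasicoherent

theorem isQuasicoherent_iff {X : Scheme.{u}} (M : X.Modules) :
    M.IsQuasicoherent ↔ ∀ (U : X.Opens), IsAffineOpen U → ∀ a : Γ(X, U),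
      LocSec M (X.basicOpen_le a) a := by
  constructor
  · intro h U hU
    rw [← isQuasicoherent_restrict_fromSpec_iff M hU]
    infer_instance
  · intro h
    refine isQuasicoherent_of_cover M (ι := X.affineOpens) (fun U => U.1) ?_ fun U => ?_
    · exact iSup_affineOpens_eq_top X
    · have hU : IsAffineOpen U.1 := U.2
      have hq := (isQuasicoherent_restrict_fromSpec_iff M hU).mpr (h U.1 U.2)
      let N := M.restrict hU.fromSpec
      have hN : IsIso N.fromTildeΓ := (isQuasicoherent_iff_isIso_fromTildeΓ N).mp hq
      let P := (presentationTilde.{u} ((modulesSpecToSheaf.obj N).presheaf.obj (.op ⊤)) .univ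
        (by simp) _ (Submodule.span_eq _))
      let P' : N.Presentation := presentationOfIso (asIso N.fromTildeΓ) P
      exact ⟨presentationOfIso
        ((Scheme.Modules.restrictFunctorComp hU.isoSpec.hom hU.fromSpec).symm.app M ≪≫
        (Scheme.Modules.restrictFunctorCongr hU.isoSpec_hom_fromSpec).app M)
        (Scheme.Modules.presentationRestrict hU.isoSpec.hom P')⟩

/-! ### Sections -/

section Sections

variable {X : Scheme.{u}}

/-- sections over `U`, as a functor to abelian groups -/
noncomputable abbrev sectionsFunctor (U : X.Opens) : X.Modules ⥤ Ab :=
  Scheme.Modules.toPresheaf X ⋙ (evaluation _ _).obj (op U)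

instance (U : X.Opens) : PreservesFiniteLimits (sectionsFunctor U) :=
  haveI : PreservesFiniteLimits (Scheme.Modules.toPresheaf X) :=
    PreservesLimitsOfSize.preservesFiniteLimits.{u, u} _
  haveI : PreservesFiniteLimits ((evaluation X.Opensᵒᵖ Ab.{u}).obj (op U)) :=
    PreservesLimitsOfSize.preservesFiniteLimits.{u, u} _
  comp_preservesFiniteLimits _ _

instance (U : X.Opens) : (sectionsFunctor U).Additive where
  map_add := rfl

theorem app_comp_apply {M N K : X.Modules} (f : M ⟶ N) (g : N ⟶ K) (U : X.Opens) (x : Γ(M, U)) :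
    (f ≫ g).app U x = g.app U (f.app U x) := rfl

theorem app_res {M N : X.Modules} (f : M ⟶ N) {U W : X.Opens} (h : W ≤ U) (x : Γ(M, U)) :
    f.app W (M.presheaf.map (homOfLE h).op x) = N.presheaf.map (homOfLE h).op (f.app U x) :=
  ConcreteCategory.congr_hom (f.mapPresheaf.naturality (homOfLE h).op) x

theorem app_injective {M N : X.Modules} (f : M ⟶ N) [Mono f] (U : X.Opens) :
    Function.Injective (f.app U) :=
  (AddCommGrpCat.mono_iff_injective _).mp (inferInstance : Mono ((sectionsFunctor U).map f))

theorem kernel_lift {M N : X.Modules} {f : M ⟶ N} {k : KernelFork f} (hk : IsLimit k)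
    (U : X.Opens) (x : Γ(M, U)) (hx : f.app U x = 0) : ∃ y : Γ(k.pt, U), k.ι.app U y = x := by
  have h1 := k.mapIsLimit hk (sectionsFunctor U)
  let S : ShortComplex Ab := ⟨(sectionsFunctor U).map k.ι, (sectionsFunctor U).map f, by
    rw [← Functor.map_comp, k.condition, Functor.map_zero]⟩
  have hS : S.Exact := S.exact_of_f_is_kernel h1
  exact (ShortComplex.ab_exact_iff S).mp hS x hx

/-- the map on sections over `U`, as a linear map -/
noncomputable def appLinear {M N : X.Modules} (f : M ⟶ N) (U : X.Opens) :
    Γ(M, U) →ₗ[Γ(X, U)] Γ(N, U) where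
  toFun := f.app U
  map_add' := map_add _
  map_smul' := f.app_smul

/-- On a locally noetherian scheme, a coherent sheaf is a quasi-coherent sheaf whose sections over
any affine open subset form a finitely generated module. -/
def IsCoherent (M : X.Modules) : Prop :=
  M.IsQuasicoherent ∧ ∀ U : X.Opens, IsAffineOpen U → Module.Finite Γ(X, U) Γ(M, U)

theorem isQuasicoherent_kernel {M N : X.Modules} {f : M ⟶ N} {k : KernelFork f} (hk : IsLimit k)
    (hM : M.IsQuasicoherent) (hN : N.IsQuasicoherent) : k.pt.IsQuasicoherent := by
  have : Mono k.ι := Fork.IsLimit.mono hk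
  rw [isQuasicoherent_iff] at *
  intro U hU a
  have hi := app_injective k.ι
  obtain ⟨m1, m2⟩ := hM U hU a
  obtain ⟨n1, n2⟩ := hN U hU a
  refine ⟨fun s => ?_, fun t ht => ?_⟩
  · obtain ⟨n, t, ht⟩ := m1 (k.ι.app _ s)
    obtain ⟨l, hl⟩ := n2 (f.app U t) (by
      rw [← app_res, ht, Scheme.Modules.Hom.app_smul, ← app_comp_apply, k.condition]
      simp)
    obtain ⟨y, hy⟩ := kernel_lift hk U (a ^ l • t) (by rw [Scheme.Modules.Hom.app_smul, hl])
    refine ⟨l + n, y, hi _ ?_⟩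
    rw [app_res, hy, Scheme.Modules.map_smul, ht, Scheme.Modules.Hom.app_smul, smul_smul, pow_add,
      map_mul]
  · obtain ⟨n, hn⟩ := m2 (k.ι.app U t) (by rw [← app_res, ht, map_zero])
    exact ⟨n, hi _ (by rw [Scheme.Modules.Hom.app_smul, hn, map_zero])⟩

theorem isCoherent_kernel [IsLocallyNoetherian X] {M N : X.Modules} {f : M ⟶ N} {k : KernelFork f}
    (hk : IsLimit k) (hM : IsCoherent M) (hN : IsCoherent N) : IsCoherent k.pt := by
  refine ⟨isQuasicoherent_kernel hk hM.1 hN.1, fun U hU => ?_⟩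
  have : Mono k.ι := Fork.IsLimit.mono hk
  have := hM.2 U hU
  have : IsNoetherianRing Γ(X, U) := IsLocallyNoetherian.component_noetherian ⟨U, hU⟩
  exact Module.Finite.of_injective (appLinear k.ι U) (app_injective k.ι U)

theorem isQuasicoherent_cokernel_spec {R : CommRingCat.{u}} {M N : (Spec R).Modules} (f : M ⟶ N)
    (hM : M.IsQuasicoherent) (hN : N.IsQuasicoherent) : (cokernel f).IsQuasicoherent := by
  have hM' : IsIso M.fromTildeΓ := (isQuasicoherent_iff_isIso_fromTildeΓ M).mp hM
  have hN' : IsIso N.fromTildeΓ := (isQuasicoherent_iff_isIso_fromTildeΓ N).mp hN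
  let eM : (tilde.functor R).obj ((modulesSpecToSheaf.obj M).presheaf.obj (.op ⊤)) ≅ M :=
    @asIso _ _ _ _ M.fromTildeΓ hM'
  let eN : (tilde.functor R).obj ((modulesSpecToSheaf.obj N).presheaf.obj (.op ⊤)) ≅ N :=
    @asIso _ _ _ _ N.fromTildeΓ hN'
  rw [isQuasicoherent_iff_isIso_fromTildeΓ, isIso_fromTildeΓ_iff]
  let g := (tilde.functor R).preimage (eM.hom ≫ f ≫ eN.inv)
  let iso : cokernel ((tilde.functor R).map g) ≅ cokernel f :=
    cokernel.mapIso _ _ eM eN (by simp [g, -tilde.functor_map])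
  exact ⟨cokernel g, ⟨PreservesCokernel.iso (tilde.functor R) g ≪≫ iso⟩⟩

theorem app_surjective_spec {R : CommRingCat.{u}} {M N : (Spec R).Modules} (f : M ⟶ N) [Epi f]
    (hM : M.IsQuasicoherent) (hN : N.IsQuasicoherent) : Function.Surjective (f.app ⊤) := by
  let P := SheafOfModules.isQuasicoherent.{u} (Spec R).ringCatSheaf
  let f' : P.FullSubcategory := ⟨M, hM⟩
  let g' : P.FullSubcategory := ⟨N, hN⟩
  let p : f' ⟶ g' := P.homMk f
  have : Epi (P.ι.map p) := inferInstanceAs (Epi f)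
  have : Epi p := P.ι.epi_of_epi_map this
  have h2 : Epi ((tildeEquiv (R := R)).inverse.map p) := inferInstance
  have h3 := (ModuleCat.epi_iff_surjective ((tildeEquiv (R := R)).inverse.map p)).mp h2
  exact h3

theorem isQuasicoherent_of_iso {M N : X.Modules} (e : M ≅ N) (hM : M.IsQuasicoherent) :
    N.IsQuasicoherent := by
  have hk : IsLimit (KernelFork.ofι (f := (0 : M ⟶ M)) e.inv (by simp)) :=
    KernelFork.IsLimit.ofId (0 : M ⟶ M) rfl |>.ofIsoLimit (Fork.ext e (by simp))
  exact isQuasicoherent_kernel hk hM hM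

theorem isQuasicoherent_cokernel {M N : X.Modules} {f : M ⟶ N} {k : CokernelCofork f}
    (hk : IsColimit k) (hM : M.IsQuasicoherent) (hN : N.IsQuasicoherent) :
    k.pt.IsQuasicoherent := by
  rw [isQuasicoherent_iff]
  intro U hU
  rw [← isQuasicoherent_restrict_fromSpec_iff _ hU]
  let F := Scheme.Modules.restrictFunctor hU.fromSpec
  have : PreservesColimitsOfSize.{0, 0} F := inferInstance
  have : F.PreservesZeroMorphisms := inferInstance
  have hk' := k.mapIsColimit hk F
  have e : cokernel (F.map f) ≅ F.obj k.pt :=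
    (cokernelIsCokernel (F.map f)).coconePointUniqueUpToIso hk'
  refine isQuasicoherent_of_iso e (isQuasicoherent_cokernel_spec _ ?_ ?_)
  · exact (isQuasicoherent_restrict_fromSpec_iff M hU).mpr ((isQuasicoherent_iff M).mp hM U hU)
  · exact (isQuasicoherent_restrict_fromSpec_iff N hU).mpr ((isQuasicoherent_iff N).mp hN U hU)

theorem app_surjective {M N : X.Modules} (f : M ⟶ N) [Epi f]
    (hM : M.IsQuasicoherent) (hN : N.IsQuasicoherent) {U : X.Opens} (hU : IsAffineOpen U) :
    Function.Surjective (f.app U) := by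
  let F := Scheme.Modules.restrictFunctor hU.fromSpec
  have : Epi (F.map f) := inferInstance
  have h1 : Function.Surjective ((F.map f).app ⊤) := app_surjective_spec (F.map f)
    ((isQuasicoherent_restrict_fromSpec_iff M hU).mpr ((isQuasicoherent_iff M).mp hM U hU))
    ((isQuasicoherent_restrict_fromSpec_iff N hU).mpr ((isQuasicoherent_iff N).mp hN U hU))
  have h2 : Function.Surjective (f.app (hU.fromSpec ''ᵁ ⊤)) := h1
  have e : hU.fromSpec ''ᵁ ⊤ = U := by simp
  rwa [e] at h2

theorem isCoherent_cokernel {M N : X.Modules} {f : M ⟶ N} {k : CokernelCofork f}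
    (hk : IsColimit k) (hM : IsCoherent M) (hN : IsCoherent N) : IsCoherent k.pt := by
  have hq := isQuasicoherent_cokernel hk hM.1 hN.1
  refine ⟨hq, fun U hU => ?_⟩
  have : Epi k.π := Cofork.IsColimit.epi hk
  have := hN.2 U hU
  exact Module.Finite.of_surjective (appLinear k.π U) (app_surjective k.π hN.1 hq hU)

theorem isCoherent_of_isZero {M : X.Modules} (h : IsZero M) : IsCoherent M := by
  have hs (U : X.Opens) : Subsingleton Γ(M, U) :=
    AddCommGrpCat.subsingleton_of_isZero ((sectionsFunctor U).map_isZero h)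
  refine ⟨(isQuasicoherent_iff M).mpr fun U hU a => ⟨fun s => ⟨0, 0, Subsingleton.elim _ _⟩,
    fun t ht => ⟨0, Subsingleton.elim _ _⟩⟩, fun U hU => inferInstance⟩

theorem isCoherent_biprod {M N : X.Modules} (hM : IsCoherent M) (hN : IsCoherent N) :
    IsCoherent (M ⊞ N) := by
  have total (U : X.Opens) (s : Γ(M ⊞ N, U)) : (biprod.inl : M ⟶ M ⊞ N).app U
      ((biprod.fst : M ⊞ N ⟶ M).app U s) + (biprod.inr : N ⟶ M ⊞ N).app U
      ((biprod.snd : M ⊞ N ⟶ N).app U s) = s := by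
    have := congr(Scheme.Modules.Hom.app $(biprod.total (X := M) (Y := N)) U s)
    exact this
  constructor
  · have hMq := (isQuasicoherent_iff M).mp hM.1
    have hNq := (isQuasicoherent_iff N).mp hN.1
    rw [isQuasicoherent_iff]
    intro U hU a
    obtain ⟨m1, m2⟩ := hMq U hU a
    obtain ⟨n1, n2⟩ := hNq U hU a
    refine ⟨fun s => ?_, fun t ht => ?_⟩
    · obtain ⟨i, x, hx⟩ := m1 ((biprod.fst : M ⊞ N ⟶ M).app _ s)
      obtain ⟨j, y, hy⟩ := n1 ((biprod.snd : M ⊞ N ⟶ N).app _ s)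
      refine ⟨j + i, (biprod.inl : M ⟶ M ⊞ N).app U (a ^ j • x) +
        (biprod.inr : N ⟶ M ⊞ N).app U (a ^ i • y), ?_⟩
      conv_rhs => rw [← total _ s]
      rw [map_add, ← app_res, ← app_res, Scheme.Modules.map_smul, Scheme.Modules.map_smul, hx, hy,
        smul_smul, smul_smul, ← map_mul, ← map_mul, ← pow_add, ← pow_add, add_comm i j,
        Scheme.Modules.Hom.app_smul, Scheme.Modules.Hom.app_smul, smul_add]
    · obtain ⟨i, hi⟩ := m2 ((biprod.fst : M ⊞ N ⟶ M).app _ t) (by rw [← app_res, ht, map_zero])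
      obtain ⟨j, hj⟩ := n2 ((biprod.snd : M ⊞ N ⟶ N).app _ t) (by rw [← app_res, ht, map_zero])
      refine ⟨i + j, ?_⟩
      have h1 := Scheme.Modules.Hom.app_smul (biprod.inl : M ⟶ M ⊞ N) (a ^ i)
        ((biprod.fst : M ⊞ N ⟶ M).app _ t)
      have h2 := Scheme.Modules.Hom.app_smul (biprod.inr : N ⟶ M ⊞ N) (a ^ j)
        ((biprod.snd : M ⊞ N ⟶ N).app _ t)
      rw [hi, map_zero] at h1
      rw [hj, map_zero] at h2
      conv_lhs => rw [← total _ t]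
      rw [smul_add, pow_add, mul_smul, mul_smul, ← h2, smul_zero, add_zero, smul_comm, ← h1,
        smul_zero]
  · intro U hU
    have := hM.2 U hU
    have := hN.2 U hU
    refine Module.Finite.of_surjective
      ((appLinear (biprod.inl : M ⟶ M ⊞ N) U).coprod (appLinear (biprod.inr : N ⟶ M ⊞ N) U))
      fun s => ⟨((biprod.fst : M ⊞ N ⟶ M).app U s, (biprod.snd : M ⊞ N ⟶ N).app U s), total U s⟩

variable (X) in
/-- the property of being a coherent sheaf -/
def coherent : ObjectProperty X.Modules := IsCoherent

instance : (coherent X).ContainsZero :=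
  ⟨⟨(HasZeroObject.zero (C := X.Modules)).choose, (HasZeroObject.zero (C := X.Modules)).choose_spec,
    isCoherent_of_isZero (HasZeroObject.zero (C := X.Modules)).choose_spec⟩⟩

instance [IsLocallyNoetherian X] : (coherent X).IsClosedUnderKernels where
  kernels_le := by
    rintro _ ⟨f, k, hk, hf⟩
    exact isCoherent_kernel hk hf.1 hf.2

instance : (coherent X).IsClosedUnderCokernels where
  cokernels_le := by
    rintro _ ⟨f, k, hk, hf⟩
    exact isCoherent_cokernel hk hf.1 hf.2

instance : (coherent X).IsClosedUnderIsomorphisms where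
  of_iso {M N} e hM := by
    have hk : IsColimit (CokernelCofork.ofπ (f := (0 : M ⟶ M)) e.hom (by simp)) :=
      CokernelCofork.IsColimit.ofId (0 : M ⟶ M) rfl |>.ofIsoColimit (Cofork.ext e (by simp))
    exact isCoherent_cokernel hk hM hM

instance : (coherent X).IsClosedUnderBinaryProducts where
  limitsOfShape_le := by
    rintro B ⟨p⟩
    let e := (IsLimit.postcomposeHomEquiv (diagramIsoPair p.diag) _).symm p.isLimit
    let e' := e.conePointUniqueUpToIso
      (BinaryBiproduct.isLimit (p.diag.obj ⟨.left⟩) (p.diag.obj ⟨.right⟩))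
    exact (coherent X).prop_of_iso e'.symm
      (isCoherent_biprod (p.prop_diag_obj ⟨.left⟩) (p.prop_diag_obj ⟨.right⟩))

instance : (coherent X).IsClosedUnderFiniteProducts := .mk'

variable (X) in
/-- the category of coherent sheaves -/
abbrev Coh := (coherent X).FullSubcategory


end Sections

section

variable {X Y : Scheme.{u}}

/-- existence of a finite global presentation -/
def FinPres (M : X.Modules) : Prop :=
  ∃ P : M.Presentation, Finite P.generators.I ∧ Finite P.relations.I

theorem FinPres.ofIso {M N : X.Modules} (e : M ≅ N) (h : FinPres M) : FinPres N := by
  obtain ⟨P, hP⟩ := h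
  exact ⟨presentationOfIso e P, hP⟩

instance (f : X ⟶ Y) : (Opens.map f.base).Final where
  out U := by
    let T : StructuredArrow U (Opens.map f.base) := StructuredArrow.mk (Y := ⊤) (homOfLE le_top)
    have : IsTerminal T := IsTerminal.ofUniqueHom
      (fun Z => StructuredArrow.homMk (homOfLE le_top) (Subsingleton.elim _ _))
      (fun Z m => by ext; exact Subsingleton.elim _ _)
    exact isConnected_of_isTerminal _ this

theorem isRightAdjoint_pushforward (f : X ⟶ Y) :
    (SheafOfModules.pushforward.{u} f.toRingCatSheafHom).IsRightAdjoint :=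
  (Scheme.Modules.pullbackPushforwardAdjunction f).isRightAdjoint

theorem FinPres.pullback (f : X ⟶ Y) {M : Y.Modules} (h : FinPres M) :
    FinPres ((Scheme.Modules.pullback f).obj M) := by
  obtain ⟨P, hP⟩ := h
  have := isRightAdjoint_pushforward f
  let F := SheafOfModules.pullback.{u} f.toRingCatSheafHom
  have : PreservesColimitsOfSize.{u, u} F :=
    (SheafOfModules.pullbackPushforwardAdjunction.{u} f.toRingCatSheafHom).leftAdjoint_preservesColimits
  have h2 : (Opens.map f.base).Final := inferInstance
  have h3 : IsIso (SheafOfModules.pullbackObjUnitToUnit.{u} f.toRingCatSheafHom) :=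
    @SheafOfModules.instIsIsoPullbackObjUnitToUnitOfFinal _ _ _ _ _ _ _ _ _ _ _ _ h2
  let e := (@asIso _ _ _ _ (SheafOfModules.pullbackObjUnitToUnit.{u} f.toRingCatSheafHom) h3).symm
  exact ⟨SheafOfModules.Presentation.map P F e, hP⟩

theorem FinPres.restrict (f : X ⟶ Y) [IsOpenImmersion f] {M : Y.Modules} (h : FinPres M) :
    FinPres (M.restrict f) :=
  (h.pullback f).ofIso ((Scheme.Modules.restrictFunctorIsoPullback f).app M).symm

theorem isCoherent_unit : IsCoherent (X := X) (SheafOfModules.unit X.ringCatSheaf) := by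
  constructor
  · refine (isQuasicoherent_iff (X := X) (SheafOfModules.unit X.ringCatSheaf)).mpr ?_
    intro U hU a
    have := hU.isLocalization_basicOpen a
    refine ⟨fun (s : Γ(X, X.basicOpen a)) => ?_, fun (t : Γ(X, U)) ht => ?_⟩
    · obtain ⟨⟨t, ⟨_, n, rfl⟩⟩, h⟩ := IsLocalization.surj (Submonoid.powers a) s
      exact ⟨n, t, (h.symm.trans (mul_comm _ _))⟩
    · obtain ⟨⟨_, n, rfl⟩, h⟩ := (IsLocalization.map_eq_zero_iff (Submonoid.powers a)
        Γ(X, X.basicOpen a) t).mp ht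
      exact ⟨n, h⟩
  · intro U hU
    exact inferInstanceAs (Module.Finite Γ(X, U) Γ(X, U))

theorem isCoherent_free (I : Type u) [Finite I] :
    IsCoherent (X := X) (SheafOfModules.free (R := X.ringCatSheaf) I) := by
  let M : X.Modules := SheafOfModules.unit X.ringCatSheaf
  have : HasFiniteBiproducts X.Modules := HasFiniteBiproducts.of_hasFiniteProducts
  have hb : HasBiproduct fun _ : I => M := HasBiproductsOfShape.has_biproduct _
  have h1 : coherent X (∏ᶜ fun _ : I => M) :=
    (coherent X).prop_of_isLimit_fan (limit.isLimit _) fun _ => isCoherent_unit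
  have e1 : (∏ᶜ fun _ : I => M) ≅ ∐ fun _ : I => M :=
    (biproduct.isoProduct _).symm ≪≫ biproduct.isoCoproduct _
  have h : IsColimit (C := X.Modules) (SheafOfModules.freeCofan (R := X.ringCatSheaf) I) :=
    SheafOfModules.isColimitFreeCofan I
  exact (coherent X).prop_of_iso (e1 ≪≫ (coproductIsCoproduct _).coconePointUniqueUpToIso h) h1

theorem FinPres.isCoherent {M : X.Modules} (h : FinPres M) : IsCoherent M := by
  obtain ⟨P, hP1, hP2⟩ := h
  have h1 := isCoherent_free (X := X) P.generators.I
  have h2 := isCoherent_free (X := X) P.relations.I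
  exact isCoherent_cokernel (X := X) P.isColimit h2 h1

theorem res_bijective_of_eq (M : X.Modules) {U W : X.Opens} (e : W = U) :
    Function.Bijective (M.presheaf.map (homOfLE e.le).op) := by
  subst e
  have : M.presheaf.map (homOfLE le_rfl).op = 𝟙 Γ(M, W) := M.presheaf.map_id _
  rw [this]
  exact Function.bijective_id

theorem finite_restrict_fromSpec {M : Y.Modules} {U : Y.Opens} (hU : IsAffineOpen U)
    (h : Module.Finite Γ(Y, U) Γ(M, U)) :
    Module.Finite Γ(Y, U) Γ(M.restrict hU.fromSpec, ⊤) := by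
  have e : hU.fromSpec ''ᵁ ⊤ = U := by simp
  let g : Γ(M, U) →ₗ[Γ(Y, U)] Γ(M.restrict hU.fromSpec, ⊤) :=
    { toFun := M.presheaf.map (homOfLE e.le).op
      map_add' := map_add _
      map_smul' := fun r x => by
        have h1 : (Scheme.ΓSpecIso Γ(Y, U)).inv =
            hU.fromSpec.appLE U ⊤ hU.fromSpec_preimage_self.ge := by
          rw [Scheme.Hom.appLE, hU.fromSpec_app_self, Category.assoc, ← Functor.map_comp,
            ← op_comp, Subsingleton.elim (_ ≫ _) (𝟙 _)]
          simp
        have h2 := ConcreteCategory.congr_hom (hU.fromSpec.appLE_appIso_inv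
          hU.fromSpec_preimage_self.ge) r
        rw [← h1] at h2
        refine (Scheme.Modules.map_smul M _ r x).trans ?_
        have h4 : (hU.fromSpec.appIso ⊤).inv (((Spec Γ(Y, U)).presheaf.map (⊤ : (Spec Γ(Y, U)).Opens).leTop.op)
          ((Scheme.ΓSpecIso Γ(Y, U)).inv r)) = Y.presheaf.map (homOfLE e.le).op r := by
          refine Eq.trans ?_ h2
          have : (⊤ : (Spec Γ(Y, U)).Opens).leTop.op = 𝟙 _ := Subsingleton.elim _ _
          rw [this, CategoryTheory.Functor.map_id]
          rfl
        rw [← h4]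
        rfl }
  exact Module.Finite.of_surjective g (res_bijective_of_eq M e).2

theorem finPres_restrict_fromSpec [IsLocallyNoetherian Y] {M : Y.Modules} (h : IsCoherent M)
    {U : Y.Opens} (hU : IsAffineOpen U) : FinPres (M.restrict hU.fromSpec) := by
  have hq := (isQuasicoherent_restrict_fromSpec_iff M hU).mpr ((isQuasicoherent_iff M).mp h.1 U hU)
  let N := M.restrict hU.fromSpec
  have hN : IsIso N.fromTildeΓ := (isQuasicoherent_iff_isIso_fromTildeΓ N).mp hq
  let eN : tilde ((modulesSpecToSheaf.obj N).presheaf.obj (.op ⊤)) ≅ N :=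
    @asIso _ _ _ _ N.fromTildeΓ hN
  refine FinPres.ofIso eN ?_
  have hf : Module.Finite Γ(Y, U) ((modulesSpecToSheaf.obj N).presheaf.obj (.op ⊤)) := by
    exact finite_restrict_fromSpec hU (h.2 U hU)
  have : IsNoetherianRing Γ(Y, U) := IsLocallyNoetherian.component_noetherian ⟨U, hU⟩
  obtain ⟨s, hs⟩ := hf
  let s' : Set ((modulesSpecToSheaf.obj N).presheaf.obj (.op ⊤)) := s
  have : Finite s' := s.finite_toSet
  have : IsNoetherian Γ(Y, U) (s' →₀ Γ(Y, U)) := inferInstance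
  obtain ⟨t, ht⟩ := IsNoetherian.noetherian (LinearMap.ker (Finsupp.linearCombination Γ(Y, U)
    ((↑) : s' → ((modulesSpecToSheaf.obj N).presheaf.obj (.op ⊤)))))
  let t' : Set (s' →₀ Γ(Y, U)) := t
  exact ⟨presentationTilde.{u} _ s' hs t' ht, s.finite_toSet, t.finite_toSet⟩

theorem finite_of_restrict (f : X ⟶ Y) [IsOpenImmersion f] {M : Y.Modules} {W : X.Opens}
    (h : Module.Finite Γ(X, W) Γ(M.restrict f, W)) :
    Module.Finite Γ(Y, f ''ᵁ W) Γ(M, f ''ᵁ W) := by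
  let σ : Γ(X, W) →+* Γ(Y, f ''ᵁ W) := (f.appIso W).inv.hom
  have : RingHomSurjective σ := ⟨(ConcreteCategory.bijective_of_isIso (f.appIso W).inv).2⟩
  let g : Γ(M.restrict f, W) →ₛₗ[σ] Γ(M, f ''ᵁ W) :=
    { toFun := fun x => x
      map_add' := fun _ _ => rfl
      map_smul' := fun _ _ => rfl }
  exact Module.Finite.of_surjective g fun x => ⟨x, rfl⟩

/-- being coherent is a local property, in the form needed here -/
theorem isCoherent_of_cover (M : X.Modules) {ι : Type u} (V : ι → X.Opens) (hV : IsOpenCover V)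
    (h : ∀ i, FinPres (M.restrict (V i).ι)) : IsCoherent M := by
  have hq : M.IsQuasicoherent := isQuasicoherent_of_cover M V hV fun i => ⟨(h i).choose⟩
  refine ⟨hq, fun U hU => ?_⟩
  let S : Set Γ(X, U) := {a | ∃ i, X.basicOpen a ≤ V i}
  have hS : Ideal.span S = ⊤ := by
    rw [← hU.iSup_basicOpen_eq_self_iff]
    refine le_antisymm (iSup_le fun a => X.basicOpen_le _) fun x hx => ?_
    obtain ⟨i, hi⟩ := hV.exists_mem x
    obtain ⟨a, ha, hxa⟩ := hU.exists_basicOpen_le (V := V i) ⟨x, hi⟩ hx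
    exact Opens.mem_iSup.mpr ⟨⟨a, i, ha⟩, hxa⟩
  have hloc := (isQuasicoherent_iff M).mp hq U hU
  let (a : S) : Module Γ(X, U) Γ(M, X.basicOpen a.1) :=
    Module.compHom _ (algebraMap Γ(X, U) Γ(X, X.basicOpen a.1))
  have (a : S) : IsScalarTower Γ(X, U) Γ(X, X.basicOpen a.1) Γ(M, X.basicOpen a.1) :=
    IsScalarTower.of_compHom _ _ _
  have (a : S) : IsLocalization.Away a.1 Γ(X, X.basicOpen a.1) := hU.isLocalization_basicOpen a.1
  let g (a : S) : Γ(M, U) →ₗ[Γ(X, U)] Γ(M, X.basicOpen a.1) :=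
    { toFun := M.presheaf.map (homOfLE (X.basicOpen_le a.1)).op
      map_add' := map_add _
      map_smul' := fun r x => Scheme.Modules.map_smul M _ r x }
  have (a : S) : IsLocalizedModule.Away a.1 (g a) := by
    refine IsLocalizedModule.Away.mk_of_addCommGroup ?_ ?_ ?_
    · have h1 : IsUnit (algebraMap Γ(X, U) Γ(X, X.basicOpen a.1) a.1) :=
        IsLocalization.Away.algebraMap_isUnit a.1
      have h2 := h1.map (algebraMap Γ(X, X.basicOpen a.1)
        (Module.End Γ(X, X.basicOpen a.1) Γ(M, X.basicOpen a.1)))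
      rw [Module.End.isUnit_iff] at h2 ⊢
      exact h2
    · intro x
      obtain ⟨n, t, ht⟩ := (hloc a.1).1 x
      exact ⟨n, t, ht.symm⟩
    · exact (hloc a.1).2
  suffices H : ∀ a : S, Module.Finite Γ(X, X.basicOpen a.1) Γ(M, X.basicOpen a.1) from
    Module.Finite.of_localizationSpan' S hS g H
  intro a
  obtain ⟨i, hi⟩ := a.2
  have hc := (h i).isCoherent
  have hD := hU.basicOpen a.1
  have hD' := hD.preimage_of_isOpenImmersion (V i).ι (by simpa using hi)
  have e : (V i).ι ''ᵁ ((V i).ι ⁻¹ᵁ X.basicOpen a.1) = X.basicOpen a.1 := by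
    rw [Scheme.Hom.image_preimage_eq_opensRange_inf, Scheme.Opens.opensRange_ι]
    exact inf_eq_right.mpr hi
  have hf := finite_of_restrict (V i).ι (hc.2 _ hD')
  rwa [e] at hf

theorem isCoherent_pullback [IsLocallyNoetherian Y] (f : X ⟶ Y) {M : Y.Modules}
    (h : IsCoherent M) : IsCoherent ((Scheme.Modules.pullback f).obj M) := by
  refine isCoherent_of_cover _ (fun U : Y.affineOpens => f ⁻¹ᵁ U.1) ?_ fun U => ?_
  · rw [IsOpenCover, ← Scheme.Hom.preimage_iSup, iSup_affineOpens_eq_top]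
    rfl
  · have hU : IsAffineOpen U.1 := U.2
    let g : (f ⁻¹ᵁ U.1 : X.Opens).toScheme ⟶ Spec Γ(Y, U.1) := (f ∣_ U.1) ≫ hU.isoSpec.hom
    have hg : (f ⁻¹ᵁ U.1).ι ≫ f = g ≫ hU.fromSpec := by
      simp [g, IsAffineOpen.isoSpec_hom_fromSpec]
    have h1 := (finPres_restrict_fromSpec h hU).pullback g
    refine h1.ofIso ?_
    exact (Scheme.Modules.pullback g).mapIso
        ((Scheme.Modules.restrictFunctorIsoPullback hU.fromSpec).app M) ≪≫
      (Scheme.Modules.pullbackComp g hU.fromSpec).app M ≪≫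
      (Scheme.Modules.pullbackCongr hg.symm).app M ≪≫
      ((Scheme.Modules.pullbackComp (f ⁻¹ᵁ U.1).ι f).app M).symm ≪≫
      ((Scheme.Modules.restrictFunctorIsoPullback (f ⁻¹ᵁ U.1).ι).app _).symm

end

section

variable {X Y : Scheme.{u}}

theorem locSec_pushforward (f : X ⟶ Y) (M : X.Modules) {U : Y.Opens} (a : Γ(Y, U))
    (h : LocSec M (X.basicOpen_le (f.app U a)) (f.app U a)) :
    LocSec ((Scheme.Modules.pushforward f).obj M) (Y.basicOpen_le a) a := by
  have key := (locSec_congr M rfl (f.preimage_basicOpen a).symm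
    (f.preimage_mono (Y.basicOpen_le a)) (X.basicOpen_le (f.app U a)) (f.app U a)
    (f.app U a) (by simp)).mpr h
  have nat (b : Γ(Y, U)) : f.app _ (Y.presheaf.map (homOfLE (Y.basicOpen_le a)).op b) =
      X.presheaf.map (homOfLE (f.preimage_mono (Y.basicOpen_le a))).op (f.app U b) :=
    ConcreteCategory.congr_hom (f.naturality (homOfLE (Y.basicOpen_le a)).op) b
  refine ⟨fun s => ?_, fun t ht => ?_⟩
  · obtain ⟨n, t, h⟩ := key.1 s
    refine ⟨n, t, h.trans ?_⟩
    rw [← map_pow, ← nat]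
    rfl
  · obtain ⟨n, h⟩ := key.2 t ht
    refine ⟨n, Eq.trans ?_ h⟩
    rw [← map_pow]
    rfl

theorem isCoherent_pushforward (f : X ⟶ Y) [IsFinite f] {M : X.Modules} (h : IsCoherent M) :
    IsCoherent ((Scheme.Modules.pushforward f).obj M) := by
  refine ⟨(isQuasicoherent_iff _).mpr fun U hU a => locSec_pushforward f M a
    ((isQuasicoherent_iff M).mp h.1 _ (hU.preimage f) _), fun U hU => ?_⟩
  have h1 := h.2 _ (hU.preimage f)
  have h2 := f.finite_app U hU
  let _ : Algebra Γ(Y, U) Γ(X, f ⁻¹ᵁ U) := (f.app U).hom.toAlgebra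
  let _ : Module Γ(Y, U) Γ(M, f ⁻¹ᵁ U) := Module.compHom _ (algebraMap Γ(Y, U) Γ(X, f ⁻¹ᵁ U))
  have : IsScalarTower Γ(Y, U) Γ(X, f ⁻¹ᵁ U) Γ(M, f ⁻¹ᵁ U) := IsScalarTower.of_compHom _ _ _
  have h2 : Module.Finite Γ(Y, U) Γ(X, f ⁻¹ᵁ U) := h2
  have h3 := Module.Finite.trans (R := Γ(Y, U)) Γ(X, f ⁻¹ᵁ U) Γ(M, f ⁻¹ᵁ U)
  exact h3

theorem epi_of_app_surjective {M N : X.Modules} (p : M ⟶ N)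
    (h : ∀ U : X.Opens, IsAffineOpen U → Function.Surjective (p.app U)) : Epi p := by
  refine Preadditive.epi_of_cancel_zero _ fun {K} φ hφ => ?_
  have aff (U : X.Opens) (hU : IsAffineOpen U) (s : Γ(N, U)) : φ.app U s = 0 := by
    obtain ⟨t, rfl⟩ := h U hU s
    rw [← app_comp_apply, hφ]
    rfl
  apply Scheme.Modules.hom_ext
  intro U
  ext s
  let F : TopCat.Sheaf Ab X := ⟨K.presheaf, K.isSheaf⟩
  refine F.eq_of_locally_eq' (fun V : {V : X.Opens // IsAffineOpen V ∧ V ≤ U} => V.1) U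
    (fun V => homOfLE V.2.2) (fun x hx => ?_) _ _ (fun V => ?_)
  · obtain ⟨V, hV, hxV, hVU⟩ := X.isBasis_affineOpens.exists_subset_of_mem_open hx U.2
    obtain ⟨W, hW, rfl⟩ := hV
    exact Opens.mem_iSup.mpr ⟨⟨W, hW, hVU⟩, hxV⟩
  · have h1 := app_res φ V.2.2 s
    rw [aff V.1 V.2.1] at h1
    refine h1.symm.trans ?_
    exact (map_zero _).symm

instance [IsLocallyNoetherian X] : PreservesFiniteLimits (coherent X).ι :=
  haveI := fun {M N : Coh X} (f : M ⟶ N) => (coherent X).preservesKernels_ι f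
  Functor.preservesFiniteLimits_of_preservesKernels _

instance [IsLocallyNoetherian X] : PreservesFiniteColimits (coherent X).ι :=
  haveI := fun {M N : Coh X} (f : M ⟶ N) => (coherent X).preservesCokernels_ι f
  Functor.preservesFiniteColimits_of_preservesCokernels _

/-- The direct image of coherent sheaves along a finite morphism. -/
noncomputable def pushforwardCoh (f : X ⟶ Y) [IsFinite f] : Coh X ⥤ Coh Y :=
  (coherent Y).lift ((coherent X).ι ⋙ Scheme.Modules.pushforward f)
    fun M => isCoherent_pushforward f M.property

instance (f : X ⟶ Y) [IsFinite f] : (pushforwardCoh f).Additive where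
  map_add := by
    intros
    apply (coherent Y).hom_ext
    rfl

/-- The inverse image of coherent sheaves. -/
noncomputable def pullbackCoh (f : X ⟶ Y) [IsLocallyNoetherian Y] : Coh Y ⥤ Coh X :=
  (coherent X).lift ((coherent Y).ι ⋙ Scheme.Modules.pullback f)
    fun M => isCoherent_pullback f M.property

instance (f : X ⟶ Y) [IsLocallyNoetherian Y] : (pullbackCoh f).Additive where
  map_add {M N} a b := by
    apply (coherent X).hom_ext
    exact (Scheme.Modules.pullback f).map_add (f := a.hom) (g := b.hom)

theorem epi_ι [IsLocallyNoetherian X] {M N : Coh X} (p : M ⟶ N) [Epi p] : Epi p.hom :=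
  inferInstanceAs (Epi ((coherent X).ι.map p))

instance [IsLocallyNoetherian X] [IsLocallyNoetherian Y] (f : X ⟶ Y) [IsFinite f] :
    (pushforwardCoh f).PreservesEpimorphisms where
  preserves {M N} p hp := by
    have := epi_ι p
    have : Epi ((coherent Y).ι.map ((pushforwardCoh f).map p)) :=
      epi_of_app_surjective ((Scheme.Modules.pushforward f).map p.hom) fun U hU =>
        app_surjective p.hom M.property.1 N.property.1 (hU.preimage f)
    exact (coherent Y).ι.epi_of_epi_map this

instance [IsLocallyNoetherian X] [IsLocallyNoetherian Y] (f : X ⟶ Y) [IsFinite f] :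
    PreservesFiniteLimits (pushforwardCoh f) := by
  have h1 : PreservesFiniteLimits (Scheme.Modules.pushforward f) :=
    haveI := (Scheme.Modules.pullbackPushforwardAdjunction f).rightAdjoint_preservesLimits
    PreservesLimitsOfSize.preservesFiniteLimits.{0, 0} _
  have h2 : PreservesFiniteLimits (pushforwardCoh f ⋙ (coherent Y).ι) :=
    comp_preservesFiniteLimits (coherent X).ι (Scheme.Modules.pushforward f)
  exact preservesFiniteLimits_of_reflects_of_preserves (pushforwardCoh f) (coherent Y).ι

instance [IsLocallyNoetherian X] [IsLocallyNoetherian Y] (f : X ⟶ Y) [IsFinite f] :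
    PreservesFiniteColimits (pushforwardCoh f) := by
  have h : ∀ S : ShortComplex (Coh X), S.ShortExact → (S.map (pushforwardCoh f)).ShortExact := by
    intro S hS
    obtain ⟨h1, h2⟩ := (pushforwardCoh f).preservesFiniteLimits_iff_forall_exact_map_and_mono.mp
      inferInstance S hS
    have := hS.epi_g
    exact { exact := h1, mono_f := h2, epi_g := inferInstanceAs (Epi ((pushforwardCoh f).map S.g)) }
  have h3 : PreservesFiniteLimits (pushforwardCoh f) ∧ PreservesFiniteColimits (pushforwardCoh f) :=
    ((Functor.exact_tfae (pushforwardCoh f)).out 0 3).mp h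
  exact h3.2

end

/-! ### Coherent sheaves of small dimension, and the tilted heart -/

section Heart

variable {X : Scheme.{u}}

/-- The support of a sheaf of modules: the points with nonzero stalk. -/
def support (M : X.Modules) : Set X := {x | Nontrivial (M.presheaf.stalk x)}

variable (X) in
/-- Coherent sheaves whose support has dimension at most `1`. -/
def cohLEOne : ObjectProperty (Coh X) := fun M => topologicalKrullDim (support M.obj) ≤ 1

variable (X) in
/-- Coherent sheaves `E` with `Hom(G, E) = 0` for all coherent `G` of dimension at most `1`. -/
def cohGETwo : ObjectProperty (Coh X) := fun E => ∀ G : Coh X, cohLEOne X G → ∀ φ : G ⟶ E, φ = 0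

variable (X) in
/-- The heart obtained by tilting the category of coherent sheaves at the torsion pair formed by
`cohLEOne X` and `cohGETwo X`: the complexes `E` with `H⁰(E)` in `cohLEOne X`, with `H⁻¹(E)` in
`cohGETwo X`, and with all other cohomology sheaves zero. -/
def tiltedHeart [IsLocallyNoetherian X] [HasDerivedCategory.{w} (Coh X)] :
    ObjectProperty (DerivedCategory (Coh X)) := fun E =>
  cohLEOne X ((DerivedCategory.homologyFunctor (Coh X) 0).obj E) ∧
  cohGETwo X ((DerivedCategory.homologyFunctor (Coh X) (-1)).obj E) ∧
  ∀ i : ℤ, i ≠ 0 → i ≠ -1 → IsZero ((DerivedCategory.homologyFunctor (Coh X) i).obj E)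

end Heart

/-! ### Derived inverse image -/

section Derived

variable {X Y : Scheme.{u}} [IsLocallyNoetherian X] [IsLocallyNoetherian Y]

variable (Y) in
/-- The quasi-isomorphisms between complexes of coherent sheaves. -/
abbrev cohQuasiIso : MorphismProperty (CochainComplex (Coh Y) ℤ) :=
  HomologicalComplex.quasiIso (Coh Y) (ComplexShape.up ℤ)

/-- The termwise inverse image of complexes of coherent sheaves, viewed in the derived category.
The functor `L f^*` is its total left derived functor. -/
noncomputable abbrev pullbackComplex (f : X ⟶ Y) [HasDerivedCategory.{w} (Coh X)] :
    CochainComplex (Coh Y) ℤ ⥤ DerivedCategory (Coh X) :=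
  (pullbackCoh f).mapHomologicalComplex (ComplexShape.up ℤ) ⋙ DerivedCategory.Q

end Derived

/-! ### Smooth projective three-folds and their base changes -/

section Geometry

variable {k : Type u} [Field k]

attribute [local instance] MvPolynomial.gradedAlgebra

/-- A smooth projective three-fold over a field `k`: an integral scheme, smooth of relative
dimension `3` over `k`, which is a closed subscheme of some projective space
`ℙⁿ = Proj k[x₀, …, xₙ]` over `k`. -/
class IsSmoothProjectiveThreefold {X : Scheme.{u}} (f : X ⟶ Spec (.of k)) : Prop where
  isIntegral : IsIntegral X
  smooth : SmoothOfRelativeDimension 3 f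
  projective : ∃ (n : ℕ)
    (i : X ⟶ Proj (MvPolynomial.homogeneousSubmodule (Fin (n + 1)) k)), IsClosedImmersion i ∧
      i ≫ Proj.toSpecZero (MvPolynomial.homogeneousSubmodule (Fin (n + 1)) k) ≫
        Spec.map (CommRingCat.ofHom
          (algebraMap k (MvPolynomial.homogeneousSubmodule (Fin (n + 1)) k 0))) = f

variable {X : Scheme.{u}} (f : X ⟶ Spec (.of k))

instance [h : IsSmoothProjectiveThreefold f] : LocallyOfFiniteType f :=
  haveI := h.smooth
  haveI : Smooth f := SmoothOfRelativeDimension.smooth 3 f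
  inferInstance

/-- The base change `X ⊗_k A`, for a `k`-algebra `A`. -/
noncomputable abbrev baseChange (A : Type u) [CommRing A] [Algebra k A] : Scheme.{u} :=
  pullback f (Spec.map (CommRingCat.ofHom (algebraMap k A)))

/-- The morphism `X ⊗_k B ⟶ X ⊗_k A` given by a homomorphism of `k`-algebras `φ : A → B`. -/
noncomputable def baseChangeMap {A B : Type u} [CommRing A] [Algebra k A] [CommRing B] [Algebra k B]
    (φ : A →ₐ[k] B) : baseChange f B ⟶ baseChange f A :=
  pullback.lift (pullback.fst _ _) (pullback.snd _ _ ≫ Spec.map (CommRingCat.ofHom φ.toRingHom)) (by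
    rw [pullback.condition, Category.assoc, ← Spec.map_comp, ← CommRingCat.ofHom_comp]
    congr 4
    exact φ.comp_algebraMap.symm)

theorem isClosedImmersion_baseChangeMap {A B : Type u} [CommRing A] [Algebra k A] [CommRing B]
    [Algebra k B] (φ : A →ₐ[k] B) (hφ : Function.Surjective φ) :
    IsClosedImmersion (baseChangeMap f φ) := by
  have h1 : IsClosedImmersion (Spec.map (CommRingCat.ofHom φ.toRingHom)) :=
    IsClosedImmersion.spec_of_surjective _ hφ
  have h2 : IsPullback (baseChangeMap f φ) (pullback.snd _ _) (pullback.snd _ _)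
      (Spec.map (CommRingCat.ofHom φ.toRingHom)) := by
    have h3 := IsPullback.of_hasPullback f (Spec.map (CommRingCat.ofHom (algebraMap k A)))
    have e : Spec.map (CommRingCat.ofHom (algebraMap k B)) =
        Spec.map (CommRingCat.ofHom φ.toRingHom) ≫
          Spec.map (CommRingCat.ofHom (algebraMap k A)) := by
      rw [← Spec.map_comp, ← CommRingCat.ofHom_comp]
      congr 2
      exact φ.comp_algebraMap.symm
    refine IsPullback.of_right (h₁₂ := pullback.fst _ _) ?_ ?_ h3
    · have h5 : baseChangeMap f φ ≫ pullback.fst _ _ = pullback.fst _ _ := pullback.lift_fst _ _ _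
      rw [h5, ← e]
      exact IsPullback.of_hasPullback f (Spec.map (CommRingCat.ofHom (algebraMap k B)))
    · exact pullback.lift_snd _ _ _
  exact MorphismProperty.of_isPullback h2.flip h1

variable {R : Type u} [CommRing R] [Algebra k R] (π : R) (m : ℕ)

/-- The thickening `X_m = X ⊗_k R/π^m`. -/
noncomputable abbrev thickening : Scheme.{u} := baseChange f (R ⧸ Ideal.span {π ^ m})

/-- The closed immersion `ι_m : X_m ⟶ X_R`. -/
noncomputable abbrev thickeningι : thickening f π m ⟶ baseChange f R :=
  baseChangeMap f (Ideal.Quotient.mkₐ k (Ideal.span {π ^ m}))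

instance : IsClosedImmersion (thickeningι f π m) :=
  isClosedImmersion_baseChangeMap f _ (Ideal.Quotient.mkₐ_surjective k _)

instance [IsSmoothProjectiveThreefold f] {A : Type u} [CommRing A] [Algebra k A]
    [IsNoetherianRing A] : IsLocallyNoetherian (baseChange f A) :=
  inferInstance

end Geometry

end PTHeart

open PTHeart

-- The thickening `X_m` is cut out in `X_R` by the single function `π ^ m`. This function is a
-- nonzerodivisor, because `X_R` is flat over the domain `R`. Hence, for a coherent sheaf `M` on
-- `X_m`, the only nonzero derived inverse images of `ι_* M` are `L⁰ = M` and `L⁻¹ = Tor₁ = M`. The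
-- triangle is the version of this statement for complexes.
--
-- The formal part concerns an adjunction `f ⊣ g` of abelian categories, with `g` exact and fully
-- faithful. It comes with an endomorphism `s` of the identity functor whose cokernel is the unit
-- and which vanishes on the image of `g` (`IsDivisor`). Call `E` torsion-free if `s.app E` is a
-- monomorphism. By the snake lemma, `f` is exact on short exact sequences with torsion-free
-- quotient. Subobjects of torsion-free objects are torsion-free, and every object is a quotient of
-- one. So an unbounded complex `G` is resolved in one step: cover it by a contractible torsion-free
-- complex `N`. The kernel `K` is again torsion-free, and `G` is quasi-isomorphic to `K[1]`.
-- Applying `f` to torsion-free resolutions gives a left adjoint of the functor induced by `g` on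
-- derived categories, and this adjoint is the total left derived functor of `f`.
--
-- For `G = g C` the snake lemma for `s` on `0 → K → N → g C → 0` gives an exact sequence `0 → C → f
-- K → f N → C → 0`. As `f N` is contractible, the cokernel of `C → f K` becomes `C` after a shift
-- by one. The shifted triangle of `0 → C → f K → coker → 0` is the required one, since `f (K[1])`
-- computes `Lf (g C)`.
--
-- The geometric part verifies `IsDivisor` for coherent sheaves. The inverse image along a closed
-- immersion is, over an affine open subset, the quotient by the ideal; here that ideal is generated
-- by `π ^ m`. Torsion-free covers come from Artin–Rees: a section `t` of `E` over an affine open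
-- `U` lifts to an extension of an ideal sheaf by a sheaf supported off `U`. Multiplying by a high
-- power of the ideal of the complement of `U` kills that kernel and leaves the restriction to `U`
-- unchanged (`exists_mono_mulCoh_of_section`).

universe w₁ w₂ v₁ v₂ u₁ u₂

namespace PTHeart

/-! ### Adapted classes and one-step resolutions of unbounded complexes -/

section Adapted

section

variable {A : Type*} [Category* A] [Abelian A]

theorem quasiIso_iff_acyclic_mappingCone {K L : CochainComplex A ℤ} (φ : K ⟶ L) :
    QuasiIso φ ↔ (CochainComplex.mappingCone φ).Acyclic := by
  rw [← HomotopyCategory.quotient_obj_mem_subcategoryAcyclic_iff_acyclic]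
  have h := HomotopyCategory.mappingCone_triangleh_distinguished φ
  have h2 := ObjectProperty.trW_iff_of_distinguished (HomotopyCategory.subcategoryAcyclic A) _ h
  rw [← HomotopyCategory.quasiIso_eq_trW_subcategoryAcyclic] at h2
  refine Iff.trans ?_ h2
  exact (HomotopyCategory.quotient_map_mem_quasiIso_iff φ).symm
end

open CochainComplex.HomComplex

variable {A B : Type*} [Category* A] [Category* B] [Abelian A] [Abelian B]

/-- A class of objects adapted to a right exact functor `f`: it is closed under subobjects and
direct sums, every object is a quotient of an object in the class, and `f` preserves short exact
sequences of objects in the class. -/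
structure IsAdapted (P : ObjectProperty A) (f : A ⥤ B) [f.Additive] : Prop where
  of_mono {X Y : A} (i : X ⟶ Y) [Mono i] : P Y → P X
  biprod {X Y : A} : P X → P Y → P (X ⊞ Y)
  exists_epi (X : A) : ∃ (Y : A) (p : Y ⟶ X), P Y ∧ Epi p
  map_shortExact (S : ShortComplex A) : S.ShortExact → P S.X₂ → P S.X₃ → (S.map f).ShortExact

namespace IsAdapted

variable {P : ObjectProperty A} {f : A ⥤ B} [f.Additive] (hP : IsAdapted P f)

include hP in
theorem of_iso {X Y : A} (e : X ≅ Y) (h : P Y) : P X := hP.of_mono e.hom h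

include hP in
theorem mappingCone {K L : CochainComplex A ℤ} (φ : K ⟶ L) (hK : ∀ n, P (K.X n))
    (hL : ∀ n, P (L.X n)) (n : ℤ) : P ((CochainComplex.mappingCone φ).X n) :=
  hP.of_iso (HomologicalComplex.homotopyCofiber.XIsoBiprod φ n (n + 1) rfl)
    (hP.biprod (hK _) (hL _))

include hP in
-- The cone of the identity of a graded object `T` with zero differential is contractible, and a
-- morphism from it to `C` is the same as a family of maps `T.X (n + 1) ⟶ C.X n`. So termwise
-- epimorphisms from the class assemble into an epimorphism of complexes. Its kernel stays in the
-- class because the class is closed under subobjects, which is why no boundedness of `C` is needed.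
theorem exists_shortExact (C : CochainComplex A ℤ) :
    ∃ (T K : CochainComplex A ℤ) (i : K ⟶ CochainComplex.mappingCone (𝟙 T))
      (p : CochainComplex.mappingCone (𝟙 T) ⟶ C) (w : i ≫ p = 0),
      (ShortComplex.mk i p w).ShortExact ∧ (∀ n, P (K.X n)) ∧
        (∀ n, P ((CochainComplex.mappingCone (𝟙 T)).X n)) := by
  choose Y p hY hp using hP.exists_epi
  -- The index `n - 1` makes the summand `T.X (n + 1)` of degree `n` of the cone the chosen cover of
  -- `C.X n`.
  let T : CochainComplex A ℤ := { X := fun n => Y (C.X (n - 1)), d := fun _ _ => 0 }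
  have hT (n : ℤ) : P (T.X n) := hY _
  let α : Cochain T C (-1) := Cochain.mk fun i j h =>
    p _ ≫ eqToHom (by congr 2)
  let q : CochainComplex.mappingCone (𝟙 T) ⟶ C :=
    CochainComplex.mappingCone.desc (𝟙 T) α
      (Cocycle.homOf (Cocycle.mk (δ (-1) 0 α) 1 rfl (δ_δ _ _ _ _))) (by simp)
  have hq : Epi q := by
    have (n : ℤ) : Epi (q.f n) := by
      have h : (CochainComplex.mappingCone.inl (𝟙 T)).v (n + 1) n (by lia) ≫ q.f n =
        α.v (n + 1) n (by lia) :=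
        CochainComplex.mappingCone.inl_v_desc_f _ _ _ _ _ _ _
      have : Epi (α.v (n + 1) n (by lia)) := by
        dsimp [α]
        infer_instance
      exact epi_of_epi_fac h
    exact HomologicalComplex.epi_of_epi_f _ this
  refine ⟨T, kernel q, kernel.ι q, q, kernel.condition q,
    { exact := ShortComplex.exact_kernel q }, fun n => ?_, fun n => ?_⟩
  · have : Mono ((kernel.ι q).f n) := inferInstance
    exact hP.of_mono ((kernel.ι q).f n) (hP.mappingCone _ hT hT n)
  · exact hP.mappingCone _ hT hT n

include hP in
-- An acyclic complex is spliced from short exact sequences of its cycles. The cycles are subobjects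
-- of the terms, hence lie in the class, so `f` preserves each of these sequences and they can be
-- spliced again.
theorem map_exactAt {K : CochainComplex A ℤ} (hK : ∀ n, P (K.X n)) (h : K.Acyclic) :
    ((f.mapHomologicalComplex (.up ℤ)).obj K).Acyclic := by
  let Z (j : ℤ) : ShortComplex A := ShortComplex.mk (K.iCycles j) (K.toCycles j (j + 1)) (by
    rw [← cancel_mono (K.iCycles (j + 1))]
    simp)
  have hepi (i j : ℤ) (hij : i + 1 = j) : Epi (K.toCycles i j) := by
    obtain rfl : (ComplexShape.up ℤ).prev j = i := by simp; omega
    exact (h j).epi_toCycles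
  have hZ (j : ℤ) : (Z j).ShortExact :=
    { exact := ShortComplex.exact_of_f_is_kernel _ <| by
        exact isKernelOfComp (c := KernelFork.ofι _ (K.iCycles_d j (j + 1))) _ _
          (K.cyclesIsKernel j (j + 1) (by simp)) _ (K.toCycles_i j (j + 1))
      mono_f := inferInstanceAs (Mono (K.iCycles j))
      epi_g := hepi j (j + 1) rfl }
  have hF (j : ℤ) : ((Z j).map f).ShortExact :=
    hP.map_shortExact _ (hZ j) (hK j) (hP.of_mono (K.iCycles (j + 1)) (hK _))
  intro n
  have h1 : Epi (f.map (K.toCycles (n - 1) n)) := by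
    obtain ⟨m, rfl⟩ : ∃ m, n = m + 1 := ⟨n - 1, by ring⟩
    rw [show m + 1 - 1 = m by ring]
    exact (hF m).epi_g
  have h2 : Mono (f.map (K.iCycles (n + 1))) := (hF (n + 1)).mono_f
  rw [HomologicalComplex.exactAt_iff' _ (n - 1) n (n + 1) (by simp) (by simp)]
  -- Exactness passes through two comparisons: replacing the left term by the cycles, onto which it
  -- maps epimorphically, and embedding the right term into the next term of the complex.
  let S : ShortComplex B := ShortComplex.mk (f.map (K.d (n - 1) n)) (f.map (K.toCycles n (n + 1)))
    (by rw [← f.map_comp, ← cancel_mono (f.map (K.iCycles (n + 1))), ← f.map_comp]; simp)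
  have hS : S.Exact := by
    let φ : S ⟶ (Z n).map f :=
      { τ₁ := f.map (K.toCycles (n - 1) n), τ₂ := 𝟙 _, τ₃ := 𝟙 _
        comm₁₂ := (f.map_comp _ _).symm.trans ((congrArg f.map (K.toCycles_i _ _)).trans
          (Category.comp_id _).symm)
        comm₂₃ := (Category.id_comp _).trans (Category.comp_id _).symm }
    have : Epi φ.τ₁ := h1
    have : IsIso φ.τ₂ := inferInstanceAs (IsIso (𝟙 _))
    have : Mono φ.τ₃ := inferInstanceAs (Mono (𝟙 _))
    exact (ShortComplex.exact_iff_of_epi_of_isIso_of_mono φ).mpr (hF n).exact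
  let ψ : S ⟶ ((f.mapHomologicalComplex (.up ℤ)).obj K).sc' (n - 1) n (n + 1) :=
    { τ₁ := 𝟙 _, τ₂ := 𝟙 _, τ₃ := f.map (K.iCycles (n + 1))
      comm₁₂ := (Category.id_comp _).trans (Category.comp_id _).symm
      comm₂₃ := (Category.id_comp _).trans ((congrArg f.map (K.toCycles_i _ _)).symm.trans
        (f.map_comp _ _)) }
  have : Epi ψ.τ₁ := inferInstanceAs (Epi (𝟙 _))
  have : IsIso ψ.τ₂ := inferInstanceAs (IsIso (𝟙 _))
  have : Mono ψ.τ₃ := h2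
  exact (ShortComplex.exact_iff_of_epi_of_isIso_of_mono ψ).mp hS

include hP in
-- The functor `f` commutes with mapping cones, and the cone of `φ` is an acyclic complex with terms
-- in the class.
theorem map_quasiIso {K L : CochainComplex A ℤ} (φ : K ⟶ L) (hK : ∀ n, P (K.X n))
    (hL : ∀ n, P (L.X n)) (h : QuasiIso φ) :
    QuasiIso ((f.mapHomologicalComplex (.up ℤ)).map φ) := by
  rw [quasiIso_iff_acyclic_mappingCone] at h ⊢
  exact fun n => (hP.map_exactAt (hP.mappingCone φ hK hL) h n).of_iso
    (CochainComplex.mappingCone.mapHomologicalComplexIso φ f)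

include hP in
-- For `0 → K → N → C → 0` exact, the cone of `K ⟶ N` maps quasi-isomorphically to `C`, and its
-- terms are direct sums of terms of `K` and `N`.
theorem exists_resolution (C : CochainComplex A ℤ) :
    ∃ (K : CochainComplex A ℤ) (φ : K ⟶ C), (∀ n, P (K.X n)) ∧ QuasiIso φ := by
  obtain ⟨T, K, i, p, w, hS, h1, h2⟩ := hP.exists_shortExact C
  exact ⟨_, CochainComplex.mappingCone.descShortComplex (.mk i p w), hP.mappingCone i h1 h2,
    CochainComplex.mappingCone.quasiIso_descShortComplex hS⟩

end IsAdapted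

end Adapted

/-! ### Adjunctions on complexes -/

section Adjunction

variable {A B : Type*} [Category* A] [Category* B] [Preadditive A] [Preadditive B]
  {f : A ⥤ B} {g : B ⥤ A} [f.Additive] [g.Additive] 

/-- The adjunction between categories of complexes induced by an adjunction. -/
def mapComplexAdjunction (adj : f ⊣ g) :
    f.mapHomologicalComplex (ComplexShape.up ℤ) ⊣ g.mapHomologicalComplex (ComplexShape.up ℤ) :=
  Adjunction.mkOfUnitCounit
    { unit := { app := fun K => { f := fun i => adj.unit.app (K.X i)
                                  comm' := fun i j _ => (adj.unit.naturality (K.d i j)).symm }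
                naturality := fun K L φ => by
                  ext i
                  exact adj.unit.naturality (φ.f i) }
      counit := { app := fun K => { f := fun i => adj.counit.app (K.X i)
                                    comm' := fun i j _ => (adj.counit.naturality (K.d i j)).symm }
                  naturality := fun K L φ => by
                    ext i
                    exact adj.counit.naturality (φ.f i) }
      left_triangle := by
        ext K i
        exact (congrArg (f.map (adj.unit.app (K.X i)) ≫ ·) (Category.id_comp _)).trans
          (adj.left_triangle_components (K.X i))
      right_triangle := by
        ext K i
        exact (congrArg (adj.unit.app (g.obj (K.X i)) ≫ ·) (Category.id_comp _)).trans
          (adj.right_triangle_components (K.X i)) }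

end Adjunction

/-! ### Morphisms out of adapted complexes in the derived category -/

section Derived

variable {A : Type u₁} {B : Type u₂} [Category.{v₁} A] [Category.{v₂} B] [Abelian A] [Abelian B]
  {f : A ⥤ B} {g : B ⥤ A} [f.Additive] [g.Additive] 

/-- The derived category is the localization of the homotopy category at quasi-isomorphisms, which
admits a calculus of fractions. A morphism that dies in the localization is therefore already killed
by precomposing with a quasi-isomorphism. -/
theorem exists_precomp_homotopy [HasDerivedCategory A] {K L : CochainComplex A ℤ} (φ : K ⟶ L)
    (h : DerivedCategory.Q.map φ = 0) :
    ∃ (K' : CochainComplex A ℤ) (s : K' ⟶ K), QuasiIso s ∧ Nonempty (Homotopy (s ≫ φ) 0) := by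
  have h1 : DerivedCategory.Qh.map ((HomotopyCategory.quotient A (ComplexShape.up ℤ)).map φ) =
      DerivedCategory.Qh.map ((HomotopyCategory.quotient A (ComplexShape.up ℤ)).map 0) := by
    rw [← cancel_mono ((DerivedCategory.quotientCompQhIso A).hom.app L),
      DerivedCategory.quotientCompQhIso_hom_naturality, h,
      DerivedCategory.quotientCompQhIso_hom_naturality, Functor.map_zero]
  obtain ⟨K', s, hs, e⟩ := (MorphismProperty.map_eq_iff_precomp DerivedCategory.Qh
    (HomotopyCategory.quasiIso A (ComplexShape.up ℤ)) _ _).mp h1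
  obtain ⟨K', rfl⟩ := HomotopyCategory.quotient_obj_surjective K'
  obtain ⟨s, rfl⟩ := (HomotopyCategory.quotient _ _).map_surjective s
  refine ⟨K', s, (HomotopyCategory.quotient_map_mem_quasiIso_iff s).mp hs,
    ⟨HomotopyCategory.homotopyOfEq _ _ ?_⟩⟩
  rw [Functor.map_comp, e, ← Functor.map_comp, comp_zero]

variable [PreservesFiniteLimits g] [PreservesFiniteColimits g] (adj : f ⊣ g)
  [HasDerivedCategory A] [HasDerivedCategory B]

/-- The morphism `K ⟶ Rg (f K)` in the derived category, for a complex `K` and an exact right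
adjoint `g` of `f`. -/
noncomputable def derivedUnit (K : CochainComplex A ℤ) :
    DerivedCategory.Q.obj K ⟶ g.mapDerivedCategory.obj
      (DerivedCategory.Q.obj ((f.mapHomologicalComplex (.up ℤ)).obj K)) :=
  DerivedCategory.Q.map ((mapComplexAdjunction adj).unit.app K) ≫
    g.mapDerivedCategoryFactors.inv.app ((f.mapHomologicalComplex (.up ℤ)).obj K)

theorem derivedUnit_naturality {K L : CochainComplex A ℤ} (φ : K ⟶ L) :
    DerivedCategory.Q.map φ ≫ derivedUnit adj L = derivedUnit adj K ≫
      g.mapDerivedCategory.map (DerivedCategory.Q.map ((f.mapHomologicalComplex (.up ℤ)).map φ)) := by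
  have h1 := (mapComplexAdjunction adj).unit.naturality φ
  have h2 := g.mapDerivedCategoryFactors.inv.naturality ((f.mapHomologicalComplex (.up ℤ)).map φ)
  dsimp at h1 h2
  simp only [derivedUnit, Category.assoc]
  rw [← h2, ← Functor.map_comp_assoc, h1, Functor.map_comp_assoc]

theorem derivedUnit_naturality_assoc {K L : CochainComplex A ℤ} (φ : K ⟶ L)
    {N : DerivedCategory A} (h : g.mapDerivedCategory.obj (DerivedCategory.Q.obj
      ((f.mapHomologicalComplex (.up ℤ)).obj L)) ⟶ N) :
    DerivedCategory.Q.map φ ≫ derivedUnit adj L ≫ h = derivedUnit adj K ≫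
      g.mapDerivedCategory.map (DerivedCategory.Q.map ((f.mapHomologicalComplex (.up ℤ)).map φ)) ≫
        h := by
  rw [← Category.assoc, derivedUnit_naturality, Category.assoc]

theorem derivedUnit_comp {K : CochainComplex A ℤ} {N : CochainComplex B ℤ}
    (φ : (f.mapHomologicalComplex (.up ℤ)).obj K ⟶ N) :
    derivedUnit adj K ≫ g.mapDerivedCategory.map (DerivedCategory.Q.map φ) =
      DerivedCategory.Q.map ((mapComplexAdjunction adj).homEquiv _ _ φ) ≫
        g.mapDerivedCategoryFactors.inv.app N := by
  have h2 := g.mapDerivedCategoryFactors.inv.naturality φ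
  dsimp at h2
  rw [Adjunction.homEquiv_unit, Functor.map_comp, derivedUnit, Category.assoc, Category.assoc, h2]

variable {P : ObjectProperty A} (hP : IsAdapted P f)

include hP in
-- This is the derived adjunction for sources `K` with adapted terms. A morphism out of `K` in the
-- derived category is a fraction whose denominator can be refined to one with an adapted source.
-- Since `f` keeps such denominators quasi-isomorphisms, the adjunction on complexes transfers to
-- fractions.
theorem derivedUnit_comp_bijective {K : CochainComplex A ℤ} (hK : ∀ n, P (K.X n))
    (M : DerivedCategory B) :
    Function.Bijective fun φ : DerivedCategory.Q.obj ((f.mapHomologicalComplex (.up ℤ)).obj K) ⟶ M =>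
      derivedUnit adj K ≫ g.mapDerivedCategory.map φ := by
  wlog hM : ∃ N, M = DerivedCategory.Q.obj N generalizing M
  · let e := DerivedCategory.Q.objObjPreimageIso M
    have h := this (DerivedCategory.Q.obj (DerivedCategory.Q.objPreimage M)) ⟨_, rfl⟩
    constructor
    · intro a b hab
      rw [← cancel_mono e.inv]
      apply h.1
      dsimp at hab ⊢
      rw [Functor.map_comp, reassoc_of% hab, Functor.map_comp]
    · intro ψ
      obtain ⟨φ, hφ⟩ := h.2 (ψ ≫ g.mapDerivedCategory.map e.inv)
      dsimp at hφ
      refine ⟨φ ≫ e.hom, ?_⟩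
      dsimp
      rw [Functor.map_comp, reassoc_of% hφ, ← Functor.map_comp]
      simp
  obtain ⟨N, rfl⟩ := hM
  have resolve (C : CochainComplex A ℤ) (s : C ⟶ K) (hs : QuasiIso s) :
      ∃ (C' : CochainComplex A ℤ) (r : C' ⟶ C), QuasiIso r ∧ QuasiIso (r ≫ s) ∧
        QuasiIso ((f.mapHomologicalComplex (.up ℤ)).map (r ≫ s)) := by
    obtain ⟨C', r, hC', hr⟩ := hP.exists_resolution C
    exact ⟨C', r, hr, inferInstance, hP.map_quasiIso _ hC' hK inferInstance⟩
  constructor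
  · intro a b hab
    rw [← sub_eq_zero] at hab ⊢
    dsimp at hab
    rw [← Preadditive.comp_sub, ← Functor.map_sub] at hab
    generalize a - b = c at hab
    -- Only the numerator `x` matters. The hypothesis says that its adjoint transpose becomes zero
    -- in the derived category, hence null-homotopic after a quasi-isomorphism that may be taken
    -- adapted.
    obtain ⟨N', x, t, ht, rfl⟩ := DerivedCategory.left_fac c
    rw [Functor.map_comp, ← Category.assoc] at hab
    replace hab := (Preadditive.IsIso.comp_right_eq_zero _ _).mp hab
    rw [derivedUnit_comp] at hab
    replace hab := (Preadditive.IsIso.comp_right_eq_zero _ _).mp hab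
    obtain ⟨C, s, hs, ⟨ho⟩⟩ := exists_precomp_homotopy _ hab
    obtain ⟨C', r, -, -, hr⟩ := resolve C s hs
    have h0 : DerivedCategory.Q.map ((f.mapHomologicalComplex (.up ℤ)).map (r ≫ s) ≫ x) = 0 := by
      -- Transposing back: this composite is `f` of a null-homotopic morphism followed by the
      -- counit.
      have h1 : (f.mapHomologicalComplex (.up ℤ)).map (r ≫ s) ≫ x =
          (f.mapHomologicalComplex (.up ℤ)).map
            (r ≫ s ≫ (mapComplexAdjunction adj).homEquiv _ _ x) ≫
            (mapComplexAdjunction adj).counit.app _ := by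
        refine Eq.trans ?_ ((mapComplexAdjunction adj).homEquiv_counit C' N' _)
        rw [← Category.assoc, Adjunction.homEquiv_naturality_left_symm, Equiv.symm_apply_apply]
      have h2 : DerivedCategory.Q.map ((f.mapHomologicalComplex (.up ℤ)).map
            (r ≫ s ≫ (mapComplexAdjunction adj).homEquiv _ _ x)) = DerivedCategory.Q.map 0 :=
        DerivedCategory.Q_map_eq_of_homotopy (C := B)
          ((f.mapHomotopy ((ho.compLeft r).trans (Homotopy.ofEq comp_zero))).trans
            (Homotopy.ofEq (Functor.map_zero _ _ _)))
      rw [h1, Functor.map_comp, h2, Functor.map_zero, zero_comp]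
    rw [Functor.map_comp] at h0
    rw [(Preadditive.IsIso.comp_left_eq_zero _ _).mp h0, zero_comp]
  · intro ψ
    obtain ⟨C, s, hs, u, hu⟩ := DerivedCategory.right_fac (ψ ≫ g.mapDerivedCategoryFactors.hom.app N)
    rw [DerivedCategory.isIso_Q_map_iff_quasiIso] at hs
    obtain ⟨C', r, hr, hrs, hfr⟩ := resolve C s hs
    refine ⟨inv (DerivedCategory.Q.map ((f.mapHomologicalComplex (.up ℤ)).map (r ≫ s))) ≫
      DerivedCategory.Q.map (((mapComplexAdjunction adj).homEquiv _ _).symm (r ≫ u)), ?_⟩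
    dsimp only
    rw [← cancel_epi (DerivedCategory.Q.map (r ≫ s)), derivedUnit_naturality_assoc,
      ← Functor.map_comp, IsIso.hom_inv_id_assoc, derivedUnit_comp, Equiv.apply_symm_apply,
      ← cancel_mono (g.mapDerivedCategoryFactors.hom.app N), Category.assoc, Category.assoc, hu]
    simp

end Derived

/-! ### The total left derived functor as a left adjoint -/

section LeftDerived

variable {A : Type u₁} {B : Type u₂} [Category.{v₁} A] [Category.{v₂} B] [Abelian A] [Abelian B]
  {f : A ⥤ B} {g : B ⥤ A} [f.Additive] [g.Additive]
  [PreservesFiniteLimits g] [PreservesFiniteColimits g] (adj : f ⊣ g)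
  [HasDerivedCategory.{w₁} A] [HasDerivedCategory.{w₂} B] {P : ObjectProperty A} (hP : IsAdapted P f)

theorem eq_comp_inv_comp {C : Type*} [Category* C] {X Y Z W : C} {a : X ⟶ Y} (p : Y ⟶ Z) [IsIso p]
    (q : Y ⟶ W) {b : X ⟶ Z} {c : X ⟶ W} (h₁ : a ≫ p = b) (h₂ : a ≫ q = c) :
    c = b ≫ inv p ≫ q := by
  rw [← h₁, ← h₂, Category.assoc, IsIso.hom_inv_id_assoc]

include adj hP in
-- Choose an adapted complex representing each object. Applying `f` to it represents the functor of
-- morphisms into the image under `g`, and representability at every object produces the left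
-- adjoint.
theorem exists_derivedAdjunction :
    ∃ (Λ : DerivedCategory A ⥤ DerivedCategory B), Nonempty (Λ ⊣ g.mapDerivedCategory) := by
  have h1 (X : DerivedCategory A) : ∃ (K : CochainComplex A ℤ) (_ : DerivedCategory.Q.obj K ≅ X),
      ∀ n, P (K.X n) := by
    obtain ⟨K, φ, hK, hφ⟩ := hP.exists_resolution (DerivedCategory.Q.objPreimage X)
    have := (DerivedCategory.isIso_Q_map_iff_quasiIso (C := A) φ).mpr hφ
    exact ⟨K, asIso (DerivedCategory.Q.map φ) ≪≫ DerivedCategory.Q.objObjPreimageIso X, hK⟩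
  choose K e hK using h1
  let E (X : DerivedCategory A) (M : DerivedCategory B) :
      (DerivedCategory.Q.obj ((f.mapHomologicalComplex (.up ℤ)).obj (K X)) ⟶ M) ≃
        (X ⟶ g.mapDerivedCategory.obj M) :=
    (Equiv.ofBijective _ (derivedUnit_comp_bijective adj hP (hK X) M)).trans
      ((e X).homFromEquiv)
  exact ⟨_, ⟨Adjunction.adjunctionOfEquivLeft E fun X M M' φ ψ => by
    simp [E, Iso.homFromEquiv]⟩⟩

variable {Λ : DerivedCategory A ⥤ DerivedCategory B} (adjΛ : Λ ⊣ g.mapDerivedCategory)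

/-- The comparison between a left adjoint `Λ` of the functor induced by `g` on derived categories
and the termwise application of the left adjoint `f` of `g`. -/
noncomputable def derivedComparison :
    DerivedCategory.Q ⋙ Λ ⟶ f.mapHomologicalComplex (.up ℤ) ⋙ DerivedCategory.Q where
  app K := (adjΛ.homEquiv _ _).symm (derivedUnit adj K)
  naturality K L φ := by
    dsimp
    rw [← Adjunction.homEquiv_naturality_left_symm, derivedUnit_naturality,
      Adjunction.homEquiv_naturality_right_symm]

include hP in
-- By Yoneda: composing with the comparison becomes, through the adjunction, composing with
-- `derivedUnit`, which is bijective on adapted complexes.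
theorem isIso_derivedComparison_app {K : CochainComplex A ℤ} (hK : ∀ n, P (K.X n)) :
    IsIso ((derivedComparison adj adjΛ).app K) := by
  rw [isIso_iff_coyoneda_map_bijective]
  intro M
  rw [← Function.Bijective.of_comp_iff' (adjΛ.homEquiv _ _).bijective]
  have h : (adjΛ.homEquiv (DerivedCategory.Q.obj K) M) ∘
      (fun φ => (derivedComparison adj adjΛ).app K ≫ φ) =
      fun φ => derivedUnit adj K ≫ g.mapDerivedCategory.map φ := by
    ext φ
    exact (adjΛ.homEquiv_naturality_right _ _).trans
      (congrArg (· ≫ _) ((adjΛ.homEquiv _ _).apply_symm_apply _))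
  exact h ▸ derivedUnit_comp_bijective adj hP hK M

include hP in
-- A total left derived functor is a right Kan extension along the localization functor. The
-- extension here is pointwise. It suffices to treat adapted `K`, since every object is isomorphic
-- to one of these. There the limit defining the pointwise value is determined by the leg at the
-- identity of `K`.
theorem isRightKanExtension_derivedComparison :
    Λ.IsRightKanExtension (derivedComparison adj adjΛ) := by
  let E := Functor.RightExtension.mk _ (derivedComparison adj adjΛ)
  have h1 (K : CochainComplex A ℤ) (hK : ∀ n, P (K.X n)) :
      Nonempty (E.IsPointwiseRightKanExtensionAt (DerivedCategory.Q.obj K)) := by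
    have := isIso_derivedComparison_app adj hP adjΛ hK
    obtain ⟨β, hβ₁, hβ₂⟩ := this.out
    -- Any leg is a function of the leg at the identity. Write `φ` as a fraction with adapted source
    -- `K''`. The two arrows of the fraction are morphisms in the indexing category, and `f` of the
    -- denominator is invertible, so cone compatibility forces the formula with a `ψ` independent of
    -- the cone.
    have key (L : CochainComplex A ℤ) (φ : DerivedCategory.Q.obj K ⟶ DerivedCategory.Q.obj L) :
        ∃ ψ : DerivedCategory.Q.obj ((f.mapHomologicalComplex (.up ℤ)).obj K) ⟶
            DerivedCategory.Q.obj ((f.mapHomologicalComplex (.up ℤ)).obj L),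
          ∀ s : Cone (StructuredArrow.proj (DerivedCategory.Q.obj K) DerivedCategory.Q ⋙
            f.mapHomologicalComplex (.up ℤ) ⋙ DerivedCategory.Q),
            s.π.app (StructuredArrow.mk φ) =
              s.π.app (StructuredArrow.mk (𝟙 (DerivedCategory.Q.obj K))) ≫ ψ := by
      obtain ⟨K', v, hv, x, rfl⟩ := DerivedCategory.right_fac φ
      obtain ⟨K'', r, hK'', hr⟩ := hP.exists_resolution K'
      rw [DerivedCategory.isIso_Q_map_iff_quasiIso] at hv
      have hrv : QuasiIso (r ≫ v) := inferInstance
      have := hP.map_quasiIso _ hK'' hK hrv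
      have := (DerivedCategory.isIso_Q_map_iff_quasiIso (C := A) (r ≫ v)).mpr hrv
      refine ⟨inv (DerivedCategory.Q.map ((f.mapHomologicalComplex (.up ℤ)).map (r ≫ v))) ≫
        DerivedCategory.Q.map ((f.mapHomologicalComplex (.up ℤ)).map (r ≫ x)), fun s => ?_⟩
      have h1 := s.w (StructuredArrow.homMk (r ≫ v) (by simp) :
        StructuredArrow.mk (inv (DerivedCategory.Q.map (r ≫ v))) ⟶
          StructuredArrow.mk (𝟙 (DerivedCategory.Q.obj K)))
      have h2 := s.w (StructuredArrow.homMk (r ≫ x) (by simp) :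
        StructuredArrow.mk (inv (DerivedCategory.Q.map (r ≫ v))) ⟶
          StructuredArrow.mk (inv (DerivedCategory.Q.map v) ≫ DerivedCategory.Q.map x))
      exact eq_comp_inv_comp (DerivedCategory.Q.map ((f.mapHomologicalComplex (.up ℤ)).map (r ≫ v)))
        (DerivedCategory.Q.map ((f.mapHomologicalComplex (.up ℤ)).map (r ≫ x))) h1 h2
    have hE : (E.coneAt (DerivedCategory.Q.obj K)).π.app
        (StructuredArrow.mk (𝟙 (DerivedCategory.Q.obj K))) =
          (derivedComparison adj adjΛ).app K :=
      (congrArg (· ≫ _) (Λ.map_id _)).trans (Category.id_comp _)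
    refine ⟨{ lift := fun s => s.π.app (StructuredArrow.mk (𝟙 (DerivedCategory.Q.obj K))) ≫ β
              fac := ?_, uniq := ?_ }⟩
    · rintro s ⟨⟨⟨⟩⟩, L, φ⟩
      obtain ⟨ψ, hψ⟩ := key L φ
      refine ((congrArg (_ ≫ ·) ((hψ (E.coneAt _)).trans (congrArg (· ≫ ψ) hE))).trans ?_).trans
        (hψ s).symm
      refine (Category.assoc _ _ _).trans (congrArg (_ ≫ ·) ?_)
      exact (Category.assoc _ _ _).symm.trans ((congrArg (· ≫ ψ) hβ₂).trans (Category.id_comp ψ))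
    · intro s m hm
      refine Eq.trans ?_ (congrArg (· ≫ β) (hm (StructuredArrow.mk (𝟙 (DerivedCategory.Q.obj K)))))
      refine Eq.trans ?_ (congrArg (fun x => (m ≫ x) ≫ β) hE.symm)
      exact ((Category.assoc _ _ _).trans ((congrArg (m ≫ ·) hβ₁).trans (Category.comp_id m))).symm
  refine Functor.RightExtension.IsPointwiseRightKanExtension.isRightKanExtension (E := E) ?_
  intro X
  apply Nonempty.some
  obtain ⟨K, φ, hK, hφ⟩ := hP.exists_resolution (DerivedCategory.Q.objPreimage X)
  have := (DerivedCategory.isIso_Q_map_iff_quasiIso (C := A) φ).mpr hφ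
  exact ⟨E.isPointwiseRightKanExtensionAtEquivOfIso'
    (asIso (DerivedCategory.Q.map φ) ≪≫ DerivedCategory.Q.objObjPreimageIso X) (h1 K hK).some⟩

end LeftDerived

/-! ### The snake lemma for an endomorphism of the identity functor -/

section Snake

variable {A : Type u₁} [Category.{v₁} A] [Abelian A] {T : A ⥤ A} [T.PreservesZeroMorphisms]
  (s : 𝟭 A ⟶ 𝟭 A) (η : 𝟭 A ⟶ T) (w : ∀ E, s.app E ≫ η.app E = 0)
  (hs : ∀ E, (ShortComplex.mk (s.app E) (η.app E) (w E)).Exact) [∀ E, Epi (η.app E)]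

/-- The snake diagram of a short exact sequence and an endomorphism `s` of the identity functor
with cokernel `η : 𝟭 A ⟶ T`. -/
noncomputable def snakeInput {S : ShortComplex A} (hS : S.ShortExact) :
    ShortComplex.SnakeInput A where
  L₀ := kernel (C := ShortComplex A) (S.mapNatTrans s)
  L₁ := S
  L₂ := S
  L₃ := S.map T
  v₀₁ := kernel.ι (C := ShortComplex A) (S.mapNatTrans s)
  v₁₂ := S.mapNatTrans s
  v₂₃ := S.mapNatTrans η
  w₀₂ := kernel.condition _
  w₁₃ := by ext <;> exact w _
  h₀ := kernelIsKernel _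
  h₃ := ShortComplex.isColimitOfIsColimitπ _
    ((CokernelCofork.isColimitMapCoconeEquiv _ _).symm (hs S.X₁).gIsCokernel)
    ((CokernelCofork.isColimitMapCoconeEquiv _ _).symm (hs S.X₂).gIsCokernel)
    ((CokernelCofork.isColimitMapCoconeEquiv _ _).symm (hs S.X₃).gIsCokernel)
  L₁_exact := hS.exact
  epi_L₁_g := hS.epi_g
  L₂_exact := hS.exact
  mono_L₂_f := hS.mono_f

include hs in
-- The kernel of `s` on the quotient vanishes, so the connecting homomorphism has zero source and
-- the cokernel sequence becomes exact on the left.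
theorem map_shortExact_of_mono {S : ShortComplex A} (hS : S.ShortExact) (h : Mono (s.app S.X₃)) :
    (S.map T).ShortExact := by
  let I := snakeInput s η w hs hS
  have := hS.epi_g
  have h0 : I.v₀₁.τ₃ = 0 := by
    have : Mono I.v₁₂.τ₃ := h
    rw [← cancel_mono I.v₁₂.τ₃, zero_comp]
    exact I.w₀₂_τ₃
  have h1 : IsZero I.L₀.X₃ := by
    rw [IsZero.iff_id_eq_zero, ← cancel_mono I.v₀₁.τ₃, h0, comp_zero, comp_zero]
  have h2 : Mono I.L₃.f := I.L₂'_exact.mono_g (h1.eq_of_src _ _)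
  have h3 : Epi I.L₂.g := hS.epi_g
  exact { exact := I.L₃_exact, mono_f := h2, epi_g := inferInstanceAs (Epi I.L₃.g) }

include hs in
-- The kernel of `s` is zero on the middle term and is everything on the quotient. The connecting
-- homomorphism therefore starts at `S.X₃` itself and is injective, which gives the exact sequence
-- `0 → S.X₃ → T S.X₁ → T S.X₂ → T S.X₃ → 0`.
theorem exists_mono_of_app_eq_zero {S : ShortComplex A} (hS : S.ShortExact)
    (h₂ : Mono (s.app S.X₂)) (h₃ : s.app S.X₃ = 0) :
    (S.map T).Exact ∧ Epi (S.map T).g ∧ ∃ (δ : S.X₃ ⟶ T.obj S.X₁) (_ : Mono δ)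
      (w : δ ≫ T.map S.f = 0), (ShortComplex.mk δ (T.map S.f) w).Exact := by
  let I := snakeInput s η w hs hS
  have h3 : Epi I.L₂.g := hS.epi_g
  have h0 : I.v₀₁.τ₂ = 0 := by
    have : Mono I.v₁₂.τ₂ := h₂
    rw [← cancel_mono I.v₁₂.τ₂, zero_comp]
    exact I.w₀₂_τ₂
  have h1 : IsZero I.L₀.X₂ := by
    rw [IsZero.iff_id_eq_zero, ← cancel_mono I.v₀₁.τ₂, h0, comp_zero, comp_zero]
  have hδ : Mono I.δ := I.L₁'_exact.mono_g (h1.eq_of_src _ _)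
  have hi : IsIso I.v₀₁.τ₃ := by
    have : Epi I.v₀₁.τ₃ := I.exact_C₃_up.epi_f h₃
    exact isIso_of_mono_of_epi _
  let e : I.L₀.X₃ ≅ I.L₁.X₃ := asIso I.v₀₁.τ₃
  have w' : (e.inv ≫ I.δ) ≫ I.L₃.f = 0 := by
    rw [Category.assoc, I.δ_L₃_f, comp_zero]
  have hm : Mono (e.inv ≫ I.δ) := mono_comp _ _
  refine ⟨I.L₃_exact, inferInstanceAs (Epi I.L₃.g), e.inv ≫ I.δ, hm, w', ?_⟩
  refine (ShortComplex.exact_iff_of_iso ?_).mp I.L₂'_exact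
  refine ShortComplex.isoMk e (Iso.refl _) (Iso.refl _) ?_ ?_
  · exact (e.hom_inv_id_assoc I.δ).trans (Category.comp_id _).symm
  · exact (Category.id_comp _).trans (Category.comp_id _).symm

end Snake

/-! ### Transport of triangles and acyclic complexes -/

section Triangle

open Pretriangulated

theorem exists_distinguished_of_iso {C : Type*} [Category* C] [HasZeroObject C] [HasShift C ℤ]
    [Preadditive C] [∀ n : ℤ, (shiftFunctor C n).Additive] [Pretriangulated C]
    {T : Triangle C} (hT : T ∈ distTriang C) {X Y Z : C} (e₁ : X ≅ T.obj₁) (e₂ : Y ≅ T.obj₂)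
    (e₃ : Z ≅ T.obj₃) : ∃ (a : X ⟶ Y) (b : Y ⟶ Z) (c : Z ⟶ X⟦(1 : ℤ)⟧),
      Triangle.mk a b c ∈ distTriang C := by
  have h₁ : (e₁.hom ≫ T.mor₁ ≫ e₂.inv) ≫ e₂.hom = e₁.hom ≫ T.mor₁ := by simp
  have h₂ : (e₂.hom ≫ T.mor₂ ≫ e₃.inv) ≫ e₃.hom = e₂.hom ≫ T.mor₂ := by simp
  have h₃ : (e₃.hom ≫ T.mor₃ ≫ e₁.inv⟦(1 : ℤ)⟧') ≫ e₁.hom⟦(1 : ℤ)⟧' = e₃.hom ≫ T.mor₃ := by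
    have h := ((shiftFunctor C (1 : ℤ)).mapIso e₁).inv_hom_id
    dsimp only [Functor.mapIso_inv, Functor.mapIso_hom] at h
    rw [Category.assoc, Category.assoc, h]
    erw [Category.comp_id]
  exact ⟨e₁.hom ≫ T.mor₁ ≫ e₂.inv, e₂.hom ≫ T.mor₂ ≫ e₃.inv, e₃.hom ≫ T.mor₃ ≫ e₁.inv⟦(1 : ℤ)⟧',
    isomorphic_distinguished _ hT _ (Triangle.isoMk _ _ e₁ e₂ e₃ h₁ h₂ h₃)⟩

/-- The zero endomorphism of an acyclic complex is a quasi-isomorphism, so zero is invertible on its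
image. -/
theorem isZero_Q_obj_of_acyclic {C : Type u₁} [Category.{v₁} C] [Abelian C]
    [HasDerivedCategory.{w₁} C] {K : CochainComplex C ℤ} (hK : K.Acyclic) :
    IsZero (DerivedCategory.Q.obj K) := by
  have h : QuasiIso (0 : K ⟶ K) :=
    ⟨fun n => (quasiIsoAt_iff_exactAt' _ _ (hK n)).mpr (hK n)⟩
  rw [← DerivedCategory.isIso_Q_map_iff_quasiIso, Functor.map_zero] at h
  exact (isIsoZeroEquivIsoZero _ _ h).1.isZero_iff.mpr (isZero_zero _)

end Triangle

/-! ### The triangle for an abstract divisor -/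

section Main

open Pretriangulated

variable {A : Type u₁} {B : Type u₂} [Category.{v₁} A] [Category.{v₂} B] [Abelian A] [Abelian B]
  {f : A ⥤ B} {g : B ⥤ A} [f.Additive] [g.Additive]
  [PreservesFiniteLimits g] [PreservesFiniteColimits g] [g.Full] [g.Faithful] (adj : f ⊣ g)

/-- An endomorphism of the identity functor of `A` such that the unit of the adjunction between `f`
and the exact fully faithful functor `g` identifies `g (f E)` with the cokernel of this endomorphism
on `E`. -/
structure IsDivisor (s : 𝟭 A ⟶ 𝟭 A) : Prop where
  w (E : A) : s.app E ≫ adj.unit.app E = 0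
  exact (E : A) : (ShortComplex.mk (s.app E) (adj.unit.app E) (w E)).Exact
  epi (E : A) : Epi (adj.unit.app E)
  app_eq_zero (M : B) : s.app (g.obj M) = 0
  exists_epi (E : A) : ∃ (Y : A) (p : Y ⟶ E), Mono (s.app Y) ∧ Epi p

namespace IsDivisor

variable {adj} {s : 𝟭 A ⟶ 𝟭 A} (h : IsDivisor adj s)

include h in
-- Naturality of `s` gives closure under subobjects and sums. Exactness comes from the snake lemma
-- for `f ⋙ g` and descends to `f` because the exact faithful functor `g` reflects it.
theorem isAdapted : IsAdapted (fun E => Mono (s.app E)) f where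
  of_mono {X Y} i _ hY := by
    have h1 : Mono (i ≫ s.app Y) := mono_comp' inferInstance hY
    have h2 : Mono (s.app X ≫ i) := (s.naturality i) ▸ h1
    exact mono_of_mono (s.app X) i
  biprod {X Y} hX hY := by
    refine Preadditive.mono_of_cancel_zero _ fun {Z} a ha => ?_
    have key {W : A} (hW : Mono (s.app W)) (p : X ⊞ Y ⟶ W) : a ≫ p = 0 := by
      have h0 : (a ≫ p) ≫ s.app W = 0 :=
        (Category.assoc _ _ _).trans ((congrArg (a ≫ ·) (s.naturality p)).trans
          ((Category.assoc _ _ _).symm.trans ((congrArg (· ≫ p) ha).trans zero_comp)))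
      exact hW.right_cancellation _ _ (h0.trans zero_comp.symm)
    refine biprod.hom_ext _ _ ?_ ?_
    · exact (key hX biprod.fst).trans zero_comp.symm
    · exact (key hY biprod.snd).trans zero_comp.symm
  exists_epi := h.exists_epi
  map_shortExact S hS h₂ h₃ := by
    have := h.epi
    have h1 := map_shortExact_of_mono s adj.unit h.w h.exact hS h₃
    have h2 : ((S.map f).map g).ShortExact := h1
    have := h2.mono_f
    have := h2.epi_g
    exact { exact := (ShortComplex.exact_map_iff_of_faithful _ g).mp h2.exact
            mono_f := g.mono_of_mono_map h2.mono_f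
            epi_g := g.epi_of_epi_map h2.epi_g }

variable (s) in
/-- The termwise action on complexes of an endomorphism of the identity functor. -/
def mapComplex : 𝟭 (CochainComplex A ℤ) ⟶ 𝟭 (CochainComplex A ℤ) where
  app K := { f := fun n => s.app (K.X n)
             comm' := fun i j _ => (s.naturality (K.d i j)).symm }
  naturality K L φ := by
    ext n
    exact s.naturality (φ.f n)

variable [HasDerivedCategory.{w₁} A] [HasDerivedCategory.{w₂} B]

include h in
-- The complex `L` is an adapted resolution of `g C`, so the middle term of the triangle is the
-- derived value of `f` at `g C`.
theorem exists_distinguished (C : CochainComplex B ℤ) :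
    ∃ (L : CochainComplex A ℤ) (_ : ∀ n, Mono (s.app (L.X n)))
      (_ : DerivedCategory.Q.obj L ≅
        DerivedCategory.Q.obj ((g.mapHomologicalComplex (.up ℤ)).obj C))
      (a : (DerivedCategory.Q.obj C)⟦(1 : ℤ)⟧ ⟶
        DerivedCategory.Q.obj ((f.mapHomologicalComplex (.up ℤ)).obj L))
      (b : DerivedCategory.Q.obj ((f.mapHomologicalComplex (.up ℤ)).obj L) ⟶
        DerivedCategory.Q.obj C)
      (c : DerivedCategory.Q.obj C ⟶ (DerivedCategory.Q.obj C)⟦(1 : ℤ)⟧⟦(1 : ℤ)⟧),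
      Triangle.mk a b c ∈ distTriang (DerivedCategory B) := by
  let F := f.mapHomologicalComplex (.up ℤ)
  let G := g.mapHomologicalComplex (.up ℤ)
  let adjC : F ⊣ G := mapComplexAdjunction adj
  obtain ⟨T, X₁, i, p, w₀, hS, h₁, h₂⟩ := h.isAdapted.exists_shortExact (G.obj C)
  let σ := mapComplex s
  have w (K : CochainComplex A ℤ) : σ.app K ≫ adjC.unit.app K = 0 := by
    ext n
    exact h.w _
  have hσ (K : CochainComplex A ℤ) :
      (ShortComplex.mk (σ.app K) (adjC.unit.app K) (w K)).Exact :=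
    HomologicalComplex.exact_of_degreewise_exact _ fun n => h.exact _
  have hη (K : CochainComplex A ℤ) : Epi (adjC.unit.app K) :=
    HomologicalComplex.epi_of_epi_f _ fun n => h.epi _
  have hσ₂ : Mono (σ.app (CochainComplex.mappingCone (𝟙 T))) := HomologicalComplex.mono_of_mono_f _ h₂
  have hσ₃ : σ.app (G.obj C) = 0 := by
    ext n
    exact h.app_eq_zero _
  -- The snake lemma is applied in the abelian category of complexes, so the connecting map is a
  -- morphism of complexes. Full faithfulness and exactness of `G` then bring the four-term sequence
  -- back to complexes over `B`.
  obtain ⟨x₁, x₂, δ, x₃, wδ, x₄⟩ := exists_mono_of_app_eq_zero σ adjC.unit w hσ hS hσ₂ hσ₃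
  dsimp only at δ wδ x₄
  obtain ⟨δ, rfl⟩ := G.map_surjective δ
  have hδ : Mono δ := G.mono_of_mono_map x₃
  have hp : Epi (F.map p) := G.epi_of_epi_map x₂
  have w₁ : δ ≫ F.map i = 0 := G.map_injective (by
    rw [G.map_comp, G.map_zero]
    exact wδ)
  have w₂ : F.map i ≫ F.map p = 0 := by rw [← F.map_comp, w₀, F.map_zero]
  have x₅ : (ShortComplex.mk δ (F.map i) w₁).Exact :=
    (ShortComplex.exact_map_iff_of_faithful _ G).mp x₄
  have x₆ : (ShortComplex.mk (F.map i) (F.map p) w₂).Exact :=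
    (ShortComplex.exact_map_iff_of_faithful _ G).mp x₁
  -- The four-term exact sequence is cut at the cokernel of `δ` into two short exact sequences.
  have hS₁ : (ShortComplex.mk δ (cokernel.π δ) (cokernel.condition δ)).ShortExact :=
    { exact := ShortComplex.exact_cokernel δ }
  have w₃ : cokernel.desc δ (F.map i) w₁ ≫ F.map p = 0 := by
    rw [← cancel_epi (cokernel.π δ), cokernel.π_desc_assoc, w₂, comp_zero]
  have hS₂ : (ShortComplex.mk (cokernel.desc δ (F.map i) w₁) (F.map p) w₃).ShortExact :=
    { exact := by
        let φ : ShortComplex.mk (F.map i) (F.map p) w₂ ⟶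
            ShortComplex.mk (cokernel.desc δ (F.map i) w₁) (F.map p) w₃ :=
          { τ₁ := cokernel.π δ, τ₂ := 𝟙 _, τ₃ := 𝟙 _ }
        have : Epi φ.τ₁ := inferInstanceAs (Epi (cokernel.π δ))
        have : IsIso φ.τ₂ := inferInstanceAs (IsIso (𝟙 _))
        have : Mono φ.τ₃ := inferInstanceAs (Mono (𝟙 _))
        exact (ShortComplex.exact_iff_of_epi_of_isIso_of_mono φ).mp x₆
      mono_f := x₅.mono_cokernelDesc }
  -- The middle complex is a cone of an identity, and so is its image under `F`. Both vanish in the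
  -- derived category, which makes the connecting maps `e₁` and `e₂` below isomorphisms.
  have z₁ : IsZero (DerivedCategory.Q.obj (CochainComplex.mappingCone (𝟙 T))) :=
    isZero_Q_obj_of_acyclic ((quasiIso_iff_acyclic_mappingCone (𝟙 T)).mp inferInstance)
  have z₂ : IsZero (DerivedCategory.Q.obj (F.obj (CochainComplex.mappingCone (𝟙 T)))) :=
    (isZero_Q_obj_of_acyclic ((quasiIso_iff_acyclic_mappingCone (F.map (𝟙 T))).mp
      inferInstance)).of_iso
      (DerivedCategory.Q.mapIso (CochainComplex.mappingCone.mapHomologicalComplexIso (𝟙 T) f))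
  have i₁ := (Triangle.isZero₂_iff_isIso₃ _ (DerivedCategory.triangleOfSES_distinguished hS)).mp z₁
  have i₂ := (Triangle.isZero₂_iff_isIso₃ _ (DerivedCategory.triangleOfSES_distinguished hS₂)).mp z₂
  let e₁ : DerivedCategory.Q.obj (G.obj C) ≅ (DerivedCategory.Q.obj X₁)⟦(1 : ℤ)⟧ :=
    @asIso _ _ _ _ (DerivedCategory.triangleOfSES hS).mor₃ i₁
  let e₂ : DerivedCategory.Q.obj (F.obj (G.obj C)) ≅ (DerivedCategory.Q.obj (cokernel δ))⟦(1 : ℤ)⟧ :=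
    @asIso _ _ _ _ (DerivedCategory.triangleOfSES hS₂).mor₃ i₂
  -- The counit is invertible because `G` is fully faithful, so the last term `F (G C)` of the
  -- four-term sequence is `C`.
  let e₃ : DerivedCategory.Q.obj C ≅ (DerivedCategory.Q.obj (cokernel δ))⟦(1 : ℤ)⟧ :=
    DerivedCategory.Q.mapIso (asIso (adjC.counit.app C)).symm ≪≫ e₂
  let e₄ : DerivedCategory.Q.obj (F.obj (X₁⟦(1 : ℤ)⟧)) ≅ (DerivedCategory.Q.obj (F.obj X₁))⟦(1 : ℤ)⟧ :=
    DerivedCategory.Q.mapIso ((F.commShiftIso (1 : ℤ)).app X₁) ≪≫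
      (DerivedCategory.Q.commShiftIso (1 : ℤ)).app (F.obj X₁)
  refine ⟨X₁⟦(1 : ℤ)⟧, fun n => h₁ _,
    (DerivedCategory.Q.commShiftIso (1 : ℤ)).app X₁ ≪≫ e₁.symm, ?_⟩
  exact exists_distinguished_of_iso (Triangle.shift_distinguished _
    (DerivedCategory.triangleOfSES_distinguished hS₁) 1) (Iso.refl _) e₄ e₃

include h in
-- The left adjoint of the derived functor of `g` is one left derived functor of `f`, and any other
-- is isomorphic to it. The triangle is therefore transported from the adapted resolution.
theorem hasLeftDerivedFunctor_and_exists_triangle :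
    (f.mapHomologicalComplex (.up ℤ) ⋙ DerivedCategory.Q (C := B)).HasLeftDerivedFunctor
      (HomologicalComplex.quasiIso A (.up ℤ)) ∧
    ∀ (Λ : DerivedCategory A ⥤ DerivedCategory B)
      (α : DerivedCategory.Q ⋙ Λ ⟶ f.mapHomologicalComplex (.up ℤ) ⋙ DerivedCategory.Q)
      [Λ.IsLeftDerivedFunctor α (HomologicalComplex.quasiIso A (.up ℤ))] (M : DerivedCategory B),
      ∃ (a : M⟦(1 : ℤ)⟧ ⟶ Λ.obj (g.mapDerivedCategory.obj M))
        (b : Λ.obj (g.mapDerivedCategory.obj M) ⟶ M) (c : M ⟶ M⟦(2 : ℤ)⟧),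
        Triangle.mk a b (c ≫ (shiftFunctorAdd' _ (1 : ℤ) 1 2 rfl).hom.app M) ∈
          distTriang (DerivedCategory B) := by
  obtain ⟨Λ₀, ⟨adjΛ⟩⟩ := exists_derivedAdjunction adj h.isAdapted
  have hΛ₀ := isRightKanExtension_derivedComparison adj h.isAdapted adjΛ
  have hΛ₁ : Λ₀.IsLeftDerivedFunctor (derivedComparison adj adjΛ)
    (HomologicalComplex.quasiIso A (.up ℤ)) := ⟨hΛ₀⟩
  refine ⟨Functor.HasLeftDerivedFunctor.mk' _ (derivedComparison adj adjΛ), ?_⟩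
  intro Λ α _ M
  let e : Λ ≅ Λ₀ := (Functor.leftDerivedUnique Λ Λ₀ (derivedComparison adj adjΛ) α
    (HomologicalComplex.quasiIso A (.up ℤ))).symm
  let C := DerivedCategory.Q.objPreimage M
  let eM : M ≅ DerivedCategory.Q.obj C := (DerivedCategory.Q.objObjPreimageIso M).symm
  obtain ⟨L, hL, eL, a, b, c, hT⟩ := h.exists_distinguished C
  have := isIso_derivedComparison_app adj h.isAdapted adjΛ hL
  let e₂ : Λ.obj (g.mapDerivedCategory.obj M) ≅
      DerivedCategory.Q.obj ((f.mapHomologicalComplex (.up ℤ)).obj L) :=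
    e.app _ ≪≫ Λ₀.mapIso (g.mapDerivedCategory.mapIso eM ≪≫
      g.mapDerivedCategoryFactors.app C ≪≫ eL.symm) ≪≫
      @asIso _ _ _ _ ((derivedComparison adj adjΛ).app L) this
  obtain ⟨a', b', c', hT'⟩ := exists_distinguished_of_iso hT
    ((shiftFunctor _ (1 : ℤ)).mapIso eM) e₂ eM
  -- The double shift in the rotated triangle is identified with the shift by two.
  refine ⟨a', b', c' ≫ (shiftFunctorAdd' _ (1 : ℤ) 1 2 rfl).inv.app M, ?_⟩
  simpa using hT'

end IsDivisor

end Main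

/-! ### Homomorphisms of quasi-coherent sheaves determined on affine open subsets -/

section QuasicoherentHom

variable {X Y : Scheme.{u}}

theorem section_eq_zero (F : X.Modules) {U : X.Opens} (s : Γ(F, U))
    (h : ∀ x ∈ U, ∃ (W : X.Opens) (hW : W ≤ U), x ∈ W ∧ F.presheaf.map (homOfLE hW).op s = 0) :
    s = 0 := by
  refine F.isSheaf.section_ext fun x hx => ?_
  obtain ⟨W, hW, hxW, h0⟩ := h x hx
  exact ⟨W, hW, hxW, h0.trans (map_zero _).symm⟩

theorem res_res (F : X.Modules) {U V W : X.Opens} (h₁ : V ≤ U) (h₂ : W ≤ V) (s : Γ(F, U)) :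
    F.presheaf.map (homOfLE h₂).op (F.presheaf.map (homOfLE h₁).op s) =
      F.presheaf.map (homOfLE (h₂.trans h₁)).op s := by
  rw [← ConcreteCategory.comp_apply, ← Functor.map_comp]
  rfl

theorem smul_basicOpen_cancel (F : X.Modules) {U : X.Opens} (a : Γ(X, U)) (n : ℕ)
    (s : Γ(F, X.basicOpen a))
    (h : X.presheaf.map (homOfLE (X.basicOpen_le a)).op (a ^ n) • s = 0) : s = 0 := by
  have h1 : IsUnit (X.presheaf.map (homOfLE (X.basicOpen_le a)).op (a ^ n)) := by
    rw [map_pow]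
    exact (RingedSpace.isUnit_res_basicOpen _ a).pow n
  exact (h1.smul_eq_zero).mp h

/-- On a basic open subset of `V`, a section of `G` times a power of the inverted function extends
to `V`, where `a` vanishes. That power is a unit on the basic open subset, and such subsets cover
`U`. -/
theorem app_eq_zero_of_le {G F : X.Modules} (hG : G.IsQuasicoherent) (a : G ⟶ F) {V : X.Opens}
    (hV : IsAffineOpen V) (h : ∀ x, a.app V x = 0) {U : X.Opens} (hU : U ≤ V) (x : Γ(G, U)) :
    a.app U x = 0 := by
  refine section_eq_zero F _ fun p hp => ?_
  obtain ⟨f, hf, hpf⟩ := hV.exists_basicOpen_le ⟨p, hp⟩ (hU hp)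
  refine ⟨X.basicOpen f, hf, hpf, ?_⟩
  rw [← app_res]
  obtain ⟨n, t, ht⟩ := ((isQuasicoherent_iff G).mp hG V hV f).1 (G.presheaf.map (homOfLE hf).op x)
  refine smul_basicOpen_cancel F f n _ ?_
  rw [← Scheme.Modules.Hom.app_smul, ← ht, app_res, h, map_zero]

theorem hom_eq_zero_of_injective {G F : X.Modules} (hG : G.IsQuasicoherent) (a : G ⟶ F)
    {V : X.Opens} (hV : IsAffineOpen V) (h : ∀ x, a.app V x = 0)
    (hF : ∀ U : X.Opens, Function.Injective
      (F.presheaf.map (homOfLE (inf_le_left : U ⊓ V ≤ U)).op)) : a = 0 := by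
  refine Scheme.Modules.hom_ext _ _ fun U => ?_
  ext x
  refine (hF U).eq_iff' (map_zero _) |>.mp ?_
  rw [← app_res]
  exact app_eq_zero_of_le hG a hV h inf_le_right _

theorem hom_eq_zero_of_cover {G F : X.Modules} (hG : G.IsQuasicoherent) (a : G ⟶ F) {ι : Type*}
    (V : ι → X.Opens) (hV : ∀ i, IsAffineOpen (V i)) (hc : IsOpenCover V)
    (h : ∀ i x, a.app (V i) x = 0) : a = 0 := by
  refine Scheme.Modules.hom_ext _ _ fun U => ?_
  ext x
  refine section_eq_zero F _ fun p hp => ?_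
  obtain ⟨i, hi⟩ := hc.exists_mem p
  refine ⟨U ⊓ V i, inf_le_left, ⟨hp, hi⟩, ?_⟩
  rw [← app_res]
  exact app_eq_zero_of_le hG a (hV i) (h i) inf_le_right _

/-- Sections over an affine open subset, as global sections of the restriction to a spectrum. -/
noncomputable def sectionsEquiv (M : Y.Modules) {U : Y.Opens} (hU : IsAffineOpen U) :
    Γ(M, U) ≃ₗ[Γ(Y, U)] Γ(M.restrict hU.fromSpec, ⊤) :=
  have e : hU.fromSpec ''ᵁ ⊤ = U := by simp
  let g : Γ(M, U) →ₗ[Γ(Y, U)] Γ(M.restrict hU.fromSpec, ⊤) :=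
    { toFun := M.presheaf.map (homOfLE e.le).op
      map_add' := map_add _
      map_smul' := fun r x => by
        have h1 : (Scheme.ΓSpecIso Γ(Y, U)).inv =
            hU.fromSpec.appLE U ⊤ hU.fromSpec_preimage_self.ge := by
          rw [Scheme.Hom.appLE, hU.fromSpec_app_self, Category.assoc, ← Functor.map_comp,
            ← op_comp, Subsingleton.elim (_ ≫ _) (𝟙 _)]
          simp
        have h2 := ConcreteCategory.congr_hom (hU.fromSpec.appLE_appIso_inv
          hU.fromSpec_preimage_self.ge) r
        rw [← h1] at h2
        refine (Scheme.Modules.map_smul M _ r x).trans ?_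
        have h4 : (hU.fromSpec.appIso ⊤).inv (((Spec Γ(Y, U)).presheaf.map
          (⊤ : (Spec Γ(Y, U)).Opens).leTop.op) ((Scheme.ΓSpecIso Γ(Y, U)).inv r)) =
            Y.presheaf.map (homOfLE e.le).op r := by
          refine Eq.trans ?_ h2
          have : (⊤ : (Spec Γ(Y, U)).Opens).leTop.op = 𝟙 _ := Subsingleton.elim _ _
          rw [this, CategoryTheory.Functor.map_id]
          rfl
        rw [← h4]
        rfl }
  LinearEquiv.ofBijective g (res_bijective_of_eq M e)

theorem restrict_map_sectionsEquiv (M : Y.Modules) {U : Y.Opens} (hU : IsAffineOpen U)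
    (x : Γ(M, U)) (W : (Spec Γ(Y, U)).Opens) :
    (M.restrict hU.fromSpec).presheaf.map (homOfLE (le_top : W ≤ ⊤)).op (sectionsEquiv M hU x) =
      M.presheaf.map (homOfLE (show hU.fromSpec ''ᵁ W ≤ U from
        (hU.fromSpec.image_mono le_top).trans (by simp))).op x :=
  res_res M (show hU.fromSpec ''ᵁ ⊤ ≤ U by simp) (hU.fromSpec.image_mono le_top) x

/-- A quasi-coherent sheaf on a spectrum is the sheaf associated with its global sections, so a
linear map of global sections induces a morphism of sheaves. -/
theorem exists_hom_spec {R : CommRingCat.{u}} {M P : (Spec R).Modules} (hM : M.IsQuasicoherent)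
    (l : Γ(M, ⊤) →ₗ[R] Γ(P, ⊤)) : ∃ φ : M ⟶ P, ∀ x, φ.app ⊤ x = l x := by
  have h : IsIso M.fromTildeΓ := (isQuasicoherent_iff_isIso_fromTildeΓ M).mp hM
  let l' : (modulesSpecToSheaf.obj M).presheaf.obj (.op ⊤) ⟶
    (modulesSpecToSheaf.obj P).presheaf.obj (.op ⊤) :=
      (ModuleCat.ofHom l : ModuleCat.of R Γ(M, ⊤) ⟶ ModuleCat.of R Γ(P, ⊤))
  let ψ : tilde ((modulesSpecToSheaf.obj M).presheaf.obj (.op ⊤)) ⟶ P :=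
    tilde.map l' ≫ P.fromTildeΓ
  have h1 : tilde.toOpen _ ⊤ ≫ (modulesSpecToSheaf.map (tilde.map l')).1.app _ =
    l' ≫ tilde.toOpen _ ⊤ := tilde.toOpen_map_app l' ⊤
  have h2 := P.toOpen_fromTildeΓ_app ⊤
  have h3 := M.toOpen_fromTildeΓ_app ⊤
  refine ⟨inv M.fromTildeΓ ≫ ψ, fun x => ?_⟩
  have e1 : M.fromTildeΓ.app ⊤ (tilde.toOpen ((modulesSpecToSheaf.obj M).presheaf.obj (.op ⊤)) ⊤ x) = x := by
    refine (ConcreteCategory.congr_hom h3 x).trans ?_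
    exact congr($((modulesSpecToSheaf.obj M).1.map_id _) x)
  have e2 : (M.fromTildeΓ ≫ inv M.fromTildeΓ ≫ ψ).app ⊤
      (tilde.toOpen ((modulesSpecToSheaf.obj M).presheaf.obj (.op ⊤)) ⊤ x) = l x := by
    rw [IsIso.hom_inv_id_assoc]
    refine (congrArg (P.fromTildeΓ.app ⊤) (ConcreteCategory.congr_hom h1 x)).trans ?_
    refine (ConcreteCategory.congr_hom h2 (l' x)).trans ?_
    exact congr($((modulesSpecToSheaf.obj P).1.map_id _) (l' x))
  refine Eq.trans ?_ e2
  exact congrArg ((inv M.fromTildeΓ ≫ ψ).app ⊤) e1.symm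

/-- By adjunction, a morphism to a sheaf pushed forward from the affine `V` is a morphism from the
restriction of `E` to `V`, hence comes from a linear map on sections. Such sheaves serve as test
objects for computing an inverse image through its universal property. -/
theorem exists_hom_pushforward_fromSpec {E : Y.Modules} (hE : E.IsQuasicoherent) {V : Y.Opens}
    (hV : IsAffineOpen V) (P : (Spec Γ(Y, V)).Modules) (l : Γ(E, V) →ₗ[Γ(Y, V)] Γ(P, ⊤)) :
    ∃ ψ : E ⟶ (Scheme.Modules.pushforward hV.fromSpec).obj P, ∀ x,
      ψ.app V x = 0 ↔ l x = 0 := by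
  have hq := (isQuasicoherent_restrict_fromSpec_iff E hV).mpr ((isQuasicoherent_iff E).mp hE V hV)
  obtain ⟨φ, hφ⟩ := exists_hom_spec hq (l ∘ₗ (sectionsEquiv E hV).symm.toLinearMap)
  refine ⟨(Scheme.Modules.restrictAdjunction hV.fromSpec).homEquiv _ _ φ, fun x => ?_⟩
  have h1 := hφ (sectionsEquiv E hV x)
  rw [LinearMap.comp_apply, LinearEquiv.coe_coe, LinearEquiv.symm_apply_apply] at h1
  have h2 : ((Scheme.Modules.restrictAdjunction hV.fromSpec).homEquiv _ _ φ).app V x =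
      P.presheaf.map (homOfLE le_top : hV.fromSpec ⁻¹ᵁ V ⟶ ⊤).op (l x) := by
    rw [← h1, ← app_res, restrict_map_sectionsEquiv, Adjunction.homEquiv_unit]
    rfl
  have h3 := (res_bijective_of_eq P hV.fromSpec_preimage_self).1
  exact ⟨fun h => h3 ((h2.symm.trans h).trans (map_zero _).symm),
    fun h => h2.trans ((congrArg _ h).trans (map_zero _))⟩

end QuasicoherentHom

/-! ### Inverse image along a closed immersion, over affine open subsets -/

section ClosedImmersion

variable {Z Y : Scheme.{u}} (i : Z ⟶ Y) [IsClosedImmersion i]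

/-- The unit of the adjunction between inverse and direct image. -/
noncomputable abbrev pullbackUnit (E : Y.Modules) :
    E ⟶ (Scheme.Modules.pushforward i).obj ((Scheme.Modules.pullback i).obj E) :=
  (Scheme.Modules.pullbackPushforwardAdjunction i).unit.app E

theorem exists_hom_tilde {E : Y.Modules} (hE : E.IsQuasicoherent) {V : Y.Opens}
    (hV : IsAffineOpen V) {N : ModuleCat Γ(Y, V)} (l : Γ(E, V) →ₗ[Γ(Y, V)] N) :
    ∃ ψ : E ⟶ (Scheme.Modules.pushforward hV.fromSpec).obj (tilde N), ∀ x,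
      ψ.app V x = 0 ↔ l x = 0 := by
  let t : N ⟶ (modulesSpecToSheaf.obj (tilde N)).presheaf.obj (.op ⊤) := tilde.toOpen N ⊤
  have ht : Function.Bijective t := ConcreteCategory.bijective_of_isIso t
  let t' : N →ₗ[Γ(Y, V)] Γ(tilde N, ⊤) := t.hom
  obtain ⟨ψ, hψ⟩ := exists_hom_pushforward_fromSpec hE hV (tilde N) (t' ∘ₗ l)
  refine ⟨ψ, fun x => ?_⟩
  rw [hψ]
  exact map_eq_zero_iff t' ht.1

theorem injective_res_pushforward_fromSpec {Y : Scheme.{u}} {V : Y.Opens} (hV : IsAffineOpen V)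
    (P : (Spec Γ(Y, V)).Modules) (U : Y.Opens) : Function.Injective
      (((Scheme.Modules.pushforward hV.fromSpec).obj P).presheaf.map
        (homOfLE (inf_le_left : U ⊓ V ≤ U)).op) := by
  have h : hV.fromSpec ⁻¹ᵁ (U ⊓ V) = hV.fromSpec ⁻¹ᵁ U := by
    rw [Scheme.Hom.preimage_inf, hV.fromSpec_preimage_self, inf_top_eq]
  exact (res_bijective_of_eq P h).1

/-- Test the inverse image against the quotient of its sections by the image of the unit. The
resulting morphism dies when composed with the unit, so it is zero by adjunction, and the quotient
is zero. -/
theorem pullbackUnit_app_surjective [IsLocallyNoetherian Y] {E : Y.Modules} (hE : IsCoherent E)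
    {V : Y.Opens} (hV : IsAffineOpen V) : Function.Surjective ((pullbackUnit i E).app V) := by
  have hM := isCoherent_pullback i hE
  set M := (Scheme.Modules.pullback i).obj E with hMdef
  have hW : IsAffineOpen (i ⁻¹ᵁ V) := hV.preimage i
  let σ : Γ(Y, V) →+* Γ(Z, i ⁻¹ᵁ V) := (i.app V).hom
  have hσ : Function.Surjective σ := i.app_surjective V hV
  have : RingHomSurjective σ := ⟨hσ⟩
  let η : Γ(E, V) →ₛₗ[σ] Γ(M, i ⁻¹ᵁ V) :=
    { toFun := (pullbackUnit i E).app V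
      map_add' := map_add _
      map_smul' := fun r x => (pullbackUnit i E).app_smul r x }
  have key : LinearMap.range η = ⊤ := by
    obtain ⟨ψ, hψ⟩ := exists_hom_tilde hM.1 hW
      (N := ModuleCat.of _ (Γ(M, i ⁻¹ᵁ V) ⧸ LinearMap.range η)) (LinearMap.range η).mkQ
    have h0 : pullbackUnit i E ≫ (Scheme.Modules.pushforward i).map ψ = 0 := by
      refine hom_eq_zero_of_injective hE.1 _ hV (fun x => ?_) fun U => ?_
      · refine (hψ (η x)).mpr ?_
        exact (Submodule.Quotient.mk_eq_zero _).mpr ⟨x, rfl⟩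
      · exact injective_res_pushforward_fromSpec hW _ (i ⁻¹ᵁ U)
    have h1 : ψ = 0 := by
      apply ((Scheme.Modules.pullbackPushforwardAdjunction i).homEquiv E _).injective
      rw [Adjunction.homEquiv_unit, Adjunction.homEquiv_unit, Functor.map_zero, comp_zero]
      exact h0
    refine eq_top_iff.mpr fun x _ => ?_
    refine (Submodule.Quotient.mk_eq_zero _).mp ((hψ x).mp ?_)
    rw [h1]
    rfl
  have h := LinearMap.range_eq_top.mp key
  exact h

/-- With `I` the kernel of `i.app V`, the quotient of `Γ(E, V)` by `I • ⊤` is a module over the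
functions on the closed subscheme. The projection to it therefore extends to a morphism from `E` to
a sheaf pushed forward along `i`, and such a morphism factors through the unit. -/
theorem mem_ker_smul_of_pullbackUnit_app_eq_zero {E : Y.Modules} (hE : E.IsQuasicoherent)
    {V : Y.Opens} (hV : IsAffineOpen V) (e : Γ(E, V)) (he : (pullbackUnit i E).app V e = 0) :
    e ∈ (RingHom.ker (i.app V).hom • ⊤ : Submodule Γ(Y, V) Γ(E, V)) := by
  have hW : IsAffineOpen (i ⁻¹ᵁ V) := hV.preimage i
  let σ : Γ(Y, V) →+* Γ(Z, i ⁻¹ᵁ V) := (i.app V).hom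
  have hσ : Function.Surjective σ := i.app_surjective V hV
  let I := RingHom.ker σ
  let N := Γ(E, V) ⧸ (I • ⊤ : Submodule Γ(Y, V) Γ(E, V))
  let q := RingHom.quotientKerEquivOfSurjective hσ
  let _ : Module Γ(Z, i ⁻¹ᵁ V) N := Module.compHom N q.symm.toRingHom
  have hq (a : Γ(Y, V)) (n : N) : σ a • n = a • n := by
    have : q.symm (σ a) = Ideal.Quotient.mk I a := by
      rw [RingEquiv.symm_apply_eq]
      rfl
    change q.symm (σ a) • n = _
    rw [this]
    induction n using Submodule.Quotient.induction_on
    rfl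
  let N' : ModuleCat Γ(Z, i ⁻¹ᵁ V) := ModuleCat.of _ N
  let φ : Spec Γ(Z, i ⁻¹ᵁ V) ⟶ Spec Γ(Y, V) := Spec.map (i.app V)
  let P : (Spec Γ(Y, V)).Modules := (Scheme.Modules.pushforward φ).obj (tilde N')
  let t : N' ⟶ (modulesSpecToSheaf.obj (tilde N')).presheaf.obj (.op ⊤) := tilde.toOpen N' ⊤
  have ht : Function.Bijective t := ConcreteCategory.bijective_of_isIso t
  let t' : N' →ₗ[Γ(Z, i ⁻¹ᵁ V)] Γ(tilde N', ⊤) := t.hom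
  have hs (r : Γ(Y, V)) (y : Γ(tilde N', ⊤)) : σ r • y = (r • (show Γ(P, ⊤) from y) : Γ(P, ⊤)) := by
    have h1 := ConcreteCategory.congr_hom (Scheme.ΓSpecIso_inv_naturality (i.app V)) r
    have h2 (X : Scheme.{u}) (x : Γ(X, ⊤)) : X.presheaf.map (⊤ : X.Opens).leTop.op x = x :=
      congr($(X.presheaf.map_id _) x)
    rw [Scheme.Modules.smul_Spec_def, Scheme.Modules.smul_Spec_def, h2, h2]
    exact congrArg (· • y) h1
  let l : Γ(E, V) →ₗ[Γ(Y, V)] Γ(P, ⊤) :=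
    { toFun := fun x => t' (Submodule.Quotient.mk x)
      map_add' := fun x y => by rw [Submodule.Quotient.mk_add, map_add]; rfl
      map_smul' := fun r x => by
        rw [Submodule.Quotient.mk_smul, ← hq, map_smul]
        exact hs r _ }
  obtain ⟨ψ, hψ⟩ := exists_hom_pushforward_fromSpec hE hV P l
  have hcomp : φ ≫ hV.fromSpec = hW.fromSpec ≫ i := by
    rw [← IsAffineOpen.SpecMap_appLE_fromSpec i hV hW le_rfl, Scheme.Hom.appLE_eq_app]
  -- The test sheaf lives on the affine piece of `Z`. Pushing it forward through `Spec Γ(Y, V)` or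
  -- through `Z` gives the same sheaf on `Y`.
  let τ : (Scheme.Modules.pushforward hV.fromSpec).obj P ≅ (Scheme.Modules.pushforward i).obj
      ((Scheme.Modules.pushforward hW.fromSpec).obj (tilde N')) :=
    (Scheme.Modules.pushforwardComp φ hV.fromSpec).app _ ≪≫
      (Scheme.Modules.pushforwardCongr hcomp).app _ ≪≫
      ((Scheme.Modules.pushforwardComp hW.fromSpec i).app _).symm
  let adj := Scheme.Modules.pullbackPushforwardAdjunction i
  have h1 : (ψ ≫ τ.hom).app V e = 0 := by
    have h2 : ψ ≫ τ.hom = pullbackUnit i E ≫ (Scheme.Modules.pushforward i).map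
        ((adj.homEquiv _ _).symm (ψ ≫ τ.hom)) := by
      rw [← Adjunction.homEquiv_unit, Equiv.apply_symm_apply]
    rw [h2, app_comp_apply, he, map_zero]
  have h3 : ψ.app V e = 0 := by
    rw [app_comp_apply] at h1
    exact (map_eq_zero_iff _ (app_injective τ.hom V)).mp h1
  rw [hψ] at h3
  exact (Submodule.Quotient.mk_eq_zero _).mp ((map_eq_zero_iff t' ht.1).mp h3)

end ClosedImmersion

/-! ### The adjunction on coherent sheaves and full faithfulness of direct image -/

section CohAdjunction

/-- Every open subset of a closed subscheme is the preimage of an open subset of the ambient scheme.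
-/
theorem isIso_of_isIso_pushforward_map {Z Y : Scheme.{u}} (i : Z ⟶ Y) [IsClosedImmersion i]
    {M N : Z.Modules} (φ : M ⟶ N)
    [h : IsIso ((Scheme.Modules.pushforward i).map φ)] : IsIso φ := by
  rw [Scheme.Modules.Hom.isIso_iff_isIso_app] at h ⊢
  intro U
  obtain ⟨V, hV, hVU⟩ := i.isClosedEmbedding.isInducing.isOpen_iff.mp U.2
  obtain rfl : i ⁻¹ᵁ ⟨V, hV⟩ = U := Opens.ext hVU
  exact h ⟨V, hV⟩

variable {Z Y : Scheme.{u}} [IsLocallyNoetherian Y] (i : Z ⟶ Y)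

/-- The adjunction between inverse and direct image of coherent sheaves. -/
noncomputable def cohAdjunction [IsFinite i] : pullbackCoh i ⊣ pushforwardCoh i :=
  Adjunction.mkOfUnitCounit
    { unit :=
        { app := fun E => ObjectProperty.homMk
            ((Scheme.Modules.pullbackPushforwardAdjunction i).unit.app E.obj)
          naturality := fun E F φ => (coherent Y).hom_ext
            ((Scheme.Modules.pullbackPushforwardAdjunction i).unit.naturality φ.hom) }
      counit :=
        { app := fun E => ObjectProperty.homMk
            ((Scheme.Modules.pullbackPushforwardAdjunction i).counit.app E.obj)
          naturality := fun E F φ => (coherent Z).hom_ext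
            ((Scheme.Modules.pullbackPushforwardAdjunction i).counit.naturality φ.hom) }
      left_triangle := by
        ext E : 2
        apply (coherent Z).hom_ext
        exact (congrArg ((Scheme.Modules.pullback i).map
          ((Scheme.Modules.pullbackPushforwardAdjunction i).unit.app E.obj) ≫ ·)
          (Category.id_comp _)).trans
          ((Scheme.Modules.pullbackPushforwardAdjunction i).left_triangle_components E.obj)
      right_triangle := by
        ext E : 2
        apply (coherent Y).hom_ext
        exact (congrArg ((Scheme.Modules.pullbackPushforwardAdjunction i).unit.app
          ((Scheme.Modules.pushforward i).obj E.obj) ≫ ·)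
          (Category.id_comp _)).trans
          ((Scheme.Modules.pullbackPushforwardAdjunction i).right_triangle_components E.obj) }

variable [IsClosedImmersion i]

theorem epi_pullbackUnit (E : Coh Y) : Epi (pullbackUnit i E.obj) :=
  epi_of_app_surjective _ fun _ hV => pullbackUnit_app_surjective i E.property hV

instance epi_cohAdjunction_unit (E : Coh Y) : Epi ((cohAdjunction i).unit.app E) :=
  (coherent Y).ι.epi_of_epi_map (epi_pullbackUnit i E)

/-- On a direct image the unit is split by the counit, and it is also an epimorphism. So it is
invertible, hence so is the direct image of the counit, and direct image reflects isomorphisms. -/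
instance isIso_cohAdjunction_counit : IsIso (cohAdjunction i).counit := by
  have (M : Coh Z) : IsIso ((cohAdjunction i).counit.app M) := by
    have h1 := (cohAdjunction i).right_triangle_components M
    have h2 : IsIso ((cohAdjunction i).unit.app ((pushforwardCoh i).obj M)) := by
      have : IsSplitMono ((cohAdjunction i).unit.app ((pushforwardCoh i).obj M)) :=
        IsSplitMono.mk' ⟨_, h1⟩
      exact isIso_of_epi_of_isSplitMono _
    have h3 : IsIso ((pushforwardCoh i).map ((cohAdjunction i).counit.app M)) := by
      rw [← IsIso.inv_eq_of_hom_inv_id h1]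
      infer_instance
    have h4 : IsIso ((Scheme.Modules.pushforward i).map ((cohAdjunction i).counit.app M).hom) :=
      inferInstanceAs (IsIso ((coherent Y).ι.map
        ((pushforwardCoh i).map ((cohAdjunction i).counit.app M))))
    have h5 : IsIso ((coherent Z).ι.map ((cohAdjunction i).counit.app M)) :=
      isIso_of_isIso_pushforward_map i ((cohAdjunction i).counit.app M).hom
    exact isIso_of_reflects_iso _ (coherent Z).ι
  exact NatIso.isIso_of_isIso_app _

instance : (pushforwardCoh i).Full := (cohAdjunction i).fullyFaithfulROfIsIsoCounit.full

instance : (pushforwardCoh i).Faithful := (cohAdjunction i).fullyFaithfulROfIsIsoCounit.faithful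

end CohAdjunction

/-! ### Multiplication by a global function -/

section GlobalSection

variable {Z Y : Scheme.{u}}

/-- The restriction of a global function to an open subset. -/
abbrev resGlobal (σ : Γ(Y, ⊤)) (U : Y.Opens) : Γ(Y, U) :=
  Y.presheaf.map (homOfLE (le_top : U ≤ ⊤)).op σ

theorem map_resGlobal (σ : Γ(Y, ⊤)) {U W : Y.Opens} (h : W ≤ U) :
    Y.presheaf.map (homOfLE h).op (resGlobal σ U) = resGlobal σ W := by
  rw [resGlobal, resGlobal, ← ConcreteCategory.comp_apply, ← Functor.map_comp]
  rfl

/-- Multiplication by a global function, on the underlying presheaf of abelian groups. -/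
noncomputable def mulGlobalPresheaf (σ : Γ(Y, ⊤)) (E : Y.Modules) : E.presheaf ⟶ E.presheaf where
  app U := AddCommGrpCat.ofHom (DistribSMul.toAddMonoidHom Γ(E, U.unop) (resGlobal σ U.unop))
  naturality U W h := by
    ext x
    refine Eq.trans ?_ (E.map_smul h.unop (resGlobal σ U.unop) x).symm
    rw [← map_resGlobal σ h.unop.le]
    rfl

/-- Multiplication by a global function, as an endomorphism of a sheaf of modules. -/
noncomputable def mulGlobal (σ : Γ(Y, ⊤)) (E : Y.Modules) : E ⟶ E :=
  ⟨PresheafOfModules.homMk (mulGlobalPresheaf σ E) fun U r x =>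
    smul_comm (M := Γ(Y, U.unop)) (N := Γ(Y, U.unop)) (α := Γ(E, U.unop)) (resGlobal σ U.unop) r x⟩

/-- Multiplication by a global function, as an endomorphism of the identity functor of the category
of coherent sheaves. -/
noncomputable def mulCoh (σ : Γ(Y, ⊤)) : 𝟭 (Coh Y) ⟶ 𝟭 (Coh Y) where
  app E := ObjectProperty.homMk (mulGlobal σ E.obj)
  naturality E F φ := by
    apply (coherent Y).hom_ext
    refine Scheme.Modules.hom_ext _ _ fun U => ?_
    ext x
    exact (φ.hom.app_smul (resGlobal σ U) x).symm

theorem mono_mulCoh_of_injective (σ : Γ(Y, ⊤)) (E : Coh Y) {ι : Type*} (V : ι → Y.Opens)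
    (hV : ∀ i, IsAffineOpen (V i)) (hc : IsOpenCover V)
    (h : ∀ i (x : Γ(E.obj, V i)), resGlobal σ (V i) • x = 0 → x = 0) : Mono ((mulCoh σ).app E) := by
  refine Preadditive.mono_of_cancel_zero _ fun {G} a ha => ?_
  apply (coherent Y).hom_ext
  refine hom_eq_zero_of_cover G.property.1 _ V hV hc fun i x => h i _ ?_
  exact congr(Scheme.Modules.Hom.app (InducedCategory.Hom.hom $ha) (V i) x)

/-- The function kills direct images from `Z`, so naturality makes its composite with the unit zero.
Conversely, a section killed by the unit lies in the ideal times `E`, and the ideal is contained in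
the one generated by `σ`, so the section is a multiple of `σ`. -/
theorem isDivisor_mulCoh [IsLocallyNoetherian Z] [IsLocallyNoetherian Y] (i : Z ⟶ Y)
    [IsClosedImmersion i] (σ : Γ(Y, ⊤)) (hσ : i.app ⊤ σ = 0)
    (hker : ∀ (V : Y.Opens), IsAffineOpen V →
      RingHom.ker (i.app V).hom ≤ Ideal.span {resGlobal σ V})
    (hE : ∀ E : Coh Y, ∃ (F : Coh Y) (p : F ⟶ E), Mono ((mulCoh σ).app F) ∧ Epi p) :
    IsDivisor (cohAdjunction i) (mulCoh σ) := by
  have h0 (M : Coh Z) : (mulCoh σ).app ((pushforwardCoh i).obj M) = 0 := by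
    apply (coherent Y).hom_ext
    refine Scheme.Modules.hom_ext _ _ fun U => ?_
    ext x
    have h1 : i.app U (resGlobal σ U) = 0 := by
      refine (ConcreteCategory.congr_hom (i.naturality (homOfLE (le_top : U ≤ ⊤)).op) σ).trans ?_
      refine (congrArg _ hσ).trans (map_zero (Z.presheaf.map _).hom)
    exact (congrArg (· • (show Γ(M.obj, i ⁻¹ᵁ U) from x)) h1).trans (zero_smul _ _)
  have hw (E : Coh Y) : (mulCoh σ).app E ≫ (cohAdjunction i).unit.app E = 0 := by
    have h1 := (mulCoh σ).naturality ((cohAdjunction i).unit.app E)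
    have h2 := h0 ((pullbackCoh i).obj E)
    exact h1.symm.trans ((congrArg (_ ≫ ·) h2).trans comp_zero)
  refine ⟨hw, fun E => ?_, epi_cohAdjunction_unit i, h0, hE⟩
  rw [ShortComplex.exact_iff_epi_kernel_lift]
  apply (coherent Y).ι.epi_of_epi_map
  have hk : Mono (kernel.ι ((cohAdjunction i).unit.app E)).hom :=
    inferInstanceAs (Mono ((coherent Y).ι.map (kernel.ι ((cohAdjunction i).unit.app E))))
  refine epi_of_app_surjective _ fun V hV x => ?_
  have h1 : ((cohAdjunction i).unit.app E).hom.app V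
      ((kernel.ι ((cohAdjunction i).unit.app E)).hom.app V x) = 0 :=
    congr(Scheme.Modules.Hom.app (InducedCategory.Hom.hom
      $(kernel.condition ((cohAdjunction i).unit.app E))) V x)
  have h2 := Submodule.smul_mono_left (hker V hV)
    (mem_ker_smul_of_pullbackUnit_app_eq_zero i E.property.1 hV _ h1)
  rw [Submodule.ideal_span_singleton_smul] at h2
  obtain ⟨e, -, he⟩ := h2
  refine ⟨e, app_injective (kernel.ι ((cohAdjunction i).unit.app E)).hom V (Eq.trans ?_ he)⟩
  exact congr(Scheme.Modules.Hom.app (InducedCategory.Hom.hom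
      $(kernel.lift_ι ((cohAdjunction i).unit.app E) ((mulCoh σ).app E) (hw E))) V e)

end GlobalSection

/-! ### Artin–Rees -/

section ArtinRees

/-- Finite generation of `N` makes the exponent for each `a` uniform, so `J` lies in the radical of
the annihilator. Finite generation of `J` then puts a power of `J` in the annihilator. -/
theorem exists_pow_smul_eq_bot {A P : Type*} [CommRing A] [IsNoetherianRing A] [AddCommGroup P]
    [Module A P] [Module.Finite A P] (J : Ideal A) (N : Submodule A P)
    (h : ∀ a ∈ J, ∀ x ∈ N, ∃ c : ℕ, a ^ c • x = 0) : ∃ c : ℕ, J ^ c • N = ⊥ := by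
  have h1 : J ≤ N.annihilator.radical := by
    intro a ha
    obtain ⟨s, hs⟩ := IsNoetherian.noetherian N
    choose! c hc using h a ha
    refine ⟨∑ x ∈ s, c x, ?_⟩
    rw [← hs, Submodule.mem_annihilator_span]
    rintro ⟨x, hx⟩
    obtain ⟨d, hd⟩ := Nat.exists_eq_add_of_le (Finset.single_le_sum_of_canonicallyOrdered (f := c) hx)
    rw [hd, add_comm, pow_add, mul_smul, hc x (hs ▸ Submodule.subset_span hx), smul_zero]
  obtain ⟨c, hc⟩ := Ideal.exists_pow_le_of_le_radical_of_fg h1 (IsNoetherian.noetherian J)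
  exact ⟨c, Submodule.le_annihilator_iff.mp hc⟩

/-- By Artin–Rees, `J ^ n • ⊤ ⊓ N` is contained in a large power of `J` times `N`, which vanishes.
-/
theorem exists_forall_pow_smul_inf_eq_bot {A P : Type*} [CommRing A] [IsNoetherianRing A]
    [AddCommGroup P] [Module A P] [Module.Finite A P] (J : Ideal A) (N : Submodule A P)
    (h : ∀ a ∈ J, ∀ x ∈ N, ∃ c : ℕ, a ^ c • x = 0) :
    ∃ n₀ : ℕ, ∀ n ≥ n₀, J ^ n • ⊤ ⊓ N = ⊥ := by
  obtain ⟨c, hc⟩ := exists_pow_smul_eq_bot J N h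
  obtain ⟨k, hk⟩ := J.exists_pow_inf_eq_pow_smul N
  refine ⟨k + c, fun n hn => ?_⟩
  rw [hk n (by omega), eq_bot_iff, ← hc]
  exact Submodule.smul_mono (Ideal.pow_le_pow_right (by omega)) inf_le_right

end ArtinRees

/-! ### Extending a section over an affine open subset -/

section Resolution

variable {Y : Scheme.{u}}

variable (Y) in
/-- The structure sheaf, as a sheaf of modules. -/
noncomputable abbrev unitModule : Y.Modules := SheafOfModules.unit Y.ringCatSheaf

/-- Multiples of a global section, as a map of presheaves of abelian groups. -/
noncomputable def presheafHomOfSection {G : Y.Modules} (s : Γ(G, ⊤)) :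
    (unitModule Y).presheaf ⟶ G.presheaf where
  app U := AddCommGrpCat.ofHom ((LinearMap.toSpanSingleton Γ(Y, U.unop) Γ(G, U.unop)
    (G.presheaf.map (homOfLE le_top).op s)).toAddMonoidHom : Γ(Y, U.unop) →+ Γ(G, U.unop))
  naturality U W h := by
    ext (x : Γ(Y, U.unop))
    have h1 := res_res G (le_top : U.unop ≤ ⊤) h.unop.le s
    refine Eq.trans ?_ (G.map_smul h.unop x _).symm
    exact congrArg ((show Γ(Y, W.unop) from Y.presheaf.map h x) • ·) h1.symm

/-- The homomorphism from the structure sheaf given by a global section. -/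
noncomputable def homOfSection {G : Y.Modules} (s : Γ(G, ⊤)) : unitModule Y ⟶ G :=
  ⟨PresheafOfModules.homMk (presheafHomOfSection s)
    fun U (r : Γ(Y, U.unop)) (x : Γ(Y, U.unop)) =>
      mul_smul r x (show Γ(G, U.unop) from G.presheaf.map (homOfLE le_top).op s)⟩

theorem homOfSection_app {G : Y.Modules} (s : Γ(G, ⊤)) (U : Y.Opens) (x : Γ(Y, U)) :
    (homOfSection s).app U x = x • G.presheaf.map (homOfLE le_top).op s := rfl

theorem biprod_ext {M N : Y.Modules} {V : Y.Opens} (x : Γ(M ⊞ N, V))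
    (h1 : (biprod.fst : M ⊞ N ⟶ M).app V x = 0) (h2 : (biprod.snd : M ⊞ N ⟶ N).app V x = 0) :
    x = 0 := by
  have := congr(Scheme.Modules.Hom.app $(biprod.total (X := M) (Y := N)) V x)
  refine this.symm.trans ?_
  change (biprod.inl : M ⟶ M ⊞ N).app V ((biprod.fst : M ⊞ N ⟶ M).app V x) +
    (biprod.inr : N ⟶ M ⊞ N).app V ((biprod.snd : M ⊞ N ⟶ N).app V x) = 0
  rw [h1, h2, map_zero, map_zero, add_zero]

theorem exists_biprod_section {M N : Y.Modules} {V : Y.Opens} (a : Γ(M, V)) (b : Γ(N, V)) :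
    ∃ y, (biprod.fst : M ⊞ N ⟶ M).app V y = a ∧ (biprod.snd : M ⊞ N ⟶ N).app V y = b := by
  refine ⟨(biprod.inl : M ⟶ M ⊞ N).app V a + (biprod.inr : N ⟶ M ⊞ N).app V b, ?_, ?_⟩
  · rw [map_add, ← app_comp_apply, ← app_comp_apply, biprod.inl_fst, biprod.inr_fst]
    exact add_zero _
  · rw [map_add, ← app_comp_apply, ← app_comp_apply, biprod.inl_snd, biprod.inr_snd]
    exact zero_add _

theorem isQuasicoherent_pushforward {X : Scheme.{u}} (f : X ⟶ Y) [IsAffineHom f] {M : X.Modules}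
    (h : M.IsQuasicoherent) : ((Scheme.Modules.pushforward f).obj M).IsQuasicoherent :=
  (isQuasicoherent_iff _).mpr fun _ hU a => locSec_pushforward f M a
    ((isQuasicoherent_iff M).mp h _ (hU.preimage f) _)

theorem isQuasicoherent_restrict {X : Scheme.{u}} (f : X ⟶ Y) [IsOpenImmersion f] {M : Y.Modules}
    (h : M.IsQuasicoherent) : (M.restrict f).IsQuasicoherent := by
  infer_instance

/-- A coherent sheaf with a section over an affine open subset `U` admits a homomorphism from an
extension of an ideal sheaf by a subsheaf supported away from `U`, through which the section
factors. -/
theorem exists_extension [IsLocallyNoetherian Y] {E : Y.Modules} (hE : IsCoherent E) (U : Y.Opens)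
    [IsAffineHom U.ι] (t : Γ(E, U)) : ∃ (P : Y.Modules) (p : P ⟶ unitModule Y) (q : P ⟶ E),
      IsCoherent P ∧
      (∀ V x, p.app V x = 0 → E.presheaf.map (homOfLE (inf_le_left : V ⊓ U ≤ V)).op (q.app V x) = 0) ∧
      (∀ V x, p.app V x = 0 → q.app V x = 0 → x = 0) ∧ ∃ x, q.app U x = t := by
  let G := (Scheme.Modules.pushforward U.ι).obj (E.restrict U.ι)
  have hG : G.IsQuasicoherent := isQuasicoherent_pushforward U.ι
    (isQuasicoherent_restrict U.ι hE.1)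
  have e (V : Y.Opens) : U.ι ''ᵁ U.ι ⁻¹ᵁ V = V ⊓ U := by
    rw [Scheme.Hom.image_preimage_eq_opensRange_inf, Scheme.Opens.opensRange_ι, inf_comm]
  let s : Γ(G, ⊤) := E.presheaf.map (homOfLE ((e ⊤).le.trans inf_le_right)).op t
  let β : E ⟶ G := (Scheme.Modules.restrictAdjunction U.ι).unit.app E
  have hβ (V : Y.Opens) (x : Γ(E, V)) : β.app V x =
      E.presheaf.map (homOfLE ((e V).le.trans inf_le_left)).op x := rfl
  -- The sheaf `P` is the kernel of `φ`: the pairs `(a, e)` with `a • t = e` on `U`. The kernel of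
  -- its projection to the structure sheaf is the sheaf of sections of `E` vanishing on `U`.
  let φ : unitModule Y ⊞ E ⟶ G := biprod.desc (homOfSection s) (-β)
  have hφ (V : Y.Opens) (x : Γ(kernel φ, V)) :
      (homOfSection s).app V ((biprod.fst : unitModule Y ⊞ E ⟶ _).app V ((kernel.ι φ).app V x)) =
        β.app V ((biprod.snd : unitModule Y ⊞ E ⟶ _).app V ((kernel.ι φ).app V x)) := by
    have h1 : kernel.ι φ ≫ biprod.fst ≫ homOfSection s = kernel.ι φ ≫ biprod.snd ≫ β := by
      rw [← sub_eq_zero, ← Preadditive.comp_sub]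
      refine Eq.trans ?_ (kernel.condition φ)
      congr 1
      apply biprod.hom_ext' <;> simp [φ]
    exact congr(Scheme.Modules.Hom.app $h1 V x)
  have hU := isCoherent_unit (X := Y)
  refine ⟨kernel φ, kernel.ι φ ≫ biprod.fst, kernel.ι φ ≫ biprod.snd, ?_, fun V x hx => ?_,
    fun V x h1 h2 => ?_, ?_⟩
  -- The sheaf `G` is quasi-coherent but need not be coherent. Finiteness of the kernel comes from
  -- the Noetherian module `unitModule Y ⊞ E` containing it.
  · have hB : IsCoherent (unitModule Y ⊞ E) := isCoherent_biprod hU hE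
    refine ⟨isQuasicoherent_kernel (k := KernelFork.ofι _ (kernel.condition φ))
      (kernelIsKernel φ) hB.1 hG, fun V hV => ?_⟩
    have := hB.2 V hV
    have : IsNoetherianRing Γ(Y, V) := IsLocallyNoetherian.component_noetherian ⟨V, hV⟩
    exact Module.Finite.of_injective (appLinear (kernel.ι φ) V) (app_injective (kernel.ι φ) V)
  · have h1 := hφ V x
    rw [app_comp_apply] at hx
    rw [hx, map_zero, hβ] at h1
    refine (res_bijective_of_eq E (e V)).1 ?_
    rw [res_res, map_zero]
    exact h1.symm
  · exact app_injective (kernel.ι φ) V ((biprod_ext _ h1 h2).trans (map_zero _).symm)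
  -- The pair `(1, t)` over `U` is the section mapping to `t`.
  · let o : Γ(unitModule Y, U) := (1 : Γ(Y, U))
    obtain ⟨y, hy1, hy2⟩ := exists_biprod_section o t
    have hy : φ.app U y = 0 := by
      have h1 : φ = biprod.fst ≫ homOfSection s - biprod.snd ≫ β := by
        apply biprod.hom_ext' <;> simp [φ]
      have h2 : (homOfSection s).app U o = β.app U t :=
        (homOfSection_app s U _).trans <| (one_smul Γ(Y, U) (G.presheaf.map (homOfLE le_top).op s)).trans
          (res_res E ((e ⊤).le.trans inf_le_right) (U.ι.image_mono (U.ι.preimage_mono le_top)) t)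
      rw [h1]
      refine sub_eq_zero_of_eq (a := (homOfSection s).app U ((biprod.fst : unitModule Y ⊞ E ⟶ _).app U y))
        (b := β.app U ((biprod.snd : unitModule Y ⊞ E ⟶ _).app U y)) ?_
      rw [hy1, hy2, h2]
    obtain ⟨x, hx⟩ := kernel_lift (k := KernelFork.ofι _ (kernel.condition φ))
      (kernelIsKernel φ) U y hy
    exact ⟨x, (congrArg _ hx).trans hy2⟩

/-- The subsheaf of sections of a coherent sheaf which vanish on an infinitesimal thickening of the
complement of an open subset. -/
theorem exists_subsheaf [IsLocallyNoetherian Y] (U : Y.Opens) : ∃ J : Y.IdealSheafData,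
    (∀ (V : Y.affineOpens), ∀ a ∈ J.ideal V, Y.basicOpen a ≤ U) ∧
    ∀ (n : ℕ) (P : Coh Y), ∃ (Q : Coh Y) (k : Q ⟶ P),
      (∀ V, Function.Injective (k.hom.app V)) ∧
      (∀ (V : Y.affineOpens) (x : Γ(Q.obj, V.1)),
        k.hom.app V.1 x ∈ (J.ideal V ^ n • ⊤ : Submodule Γ(Y, V.1) Γ(P.obj, V.1))) ∧
      Function.Surjective (k.hom.app U) := by
  let T : Closeds Y := ⟨(U : Set Y)ᶜ, U.2.isClosed_compl⟩
  let J := Scheme.IdealSheafData.vanishingIdeal T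
  have hJ : (J.support : Set Y) = (U : Set Y)ᶜ := Scheme.IdealSheafData.coe_support_vanishingIdeal T
  refine ⟨J, fun V a ha x hx => ?_, fun n P => ?_⟩
  · by_contra hxU
    have h1 : x ∈ J.support := by
      change x ∈ (J.support : Set Y)
      rw [hJ]
      exact hxU
    rw [Scheme.IdealSheafData.mem_support_iff_of_mem (Y.basicOpen_le a hx),
      Scheme.mem_zeroLocus_iff] at h1
    exact h1 a ha hx
  -- The subsheaf is the kernel of `P ⟶ i_* i^* P`, where `i` is the closed subscheme defined by `J
  -- ^ n`. Its sections over affines lie in `J ^ n • ⊤`, and over `U` it is all of `P` since the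
  -- subscheme does not meet `U`.
  · let i := (J ^ n).subschemeι
    let η := (cohAdjunction i).unit.app P
    have hη : Mono (kernel.ι η).hom := inferInstanceAs (Mono ((coherent Y).ι.map (kernel.ι η)))
    refine ⟨kernel η, kernel.ι η, fun V => app_injective (kernel.ι η).hom V, fun V x => ?_,
      fun x => ?_⟩
    · have h1 : η.hom.app V.1 ((kernel.ι η).hom.app V.1 x) = 0 :=
        congr(Scheme.Modules.Hom.app (InducedCategory.Hom.hom $(kernel.condition η)) V.1 x)
      have h2 := mem_ker_smul_of_pullbackUnit_app_eq_zero i P.property.1 V.2 _ h1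
      rwa [Scheme.IdealSheafData.ker_subschemeι_app, Scheme.IdealSheafData.ideal_pow] at h2
    · have h1 : i ⁻¹ᵁ U = ⊥ := by
        rw [eq_bot_iff]
        intro z hz
        have h2 : i z ∈ ((J ^ n).support : Set Y) := by
          rw [← Scheme.IdealSheafData.range_subschemeι]
          exact ⟨z, rfl⟩
        -- For `n = 0` the subscheme is empty; for positive `n` its support is the complement of
        -- `U`.
        cases n with
        | zero => simp at h2
        | succ n =>
          rw [Scheme.IdealSheafData.support_pow_succ, hJ] at h2
          exact (h2 hz).elim
      have h3 : IsLimit ((KernelFork.ofι (kernel.ι η) (kernel.condition η)).map (coherent Y).ι) :=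
        KernelFork.mapIsLimit _ (kernelIsKernel η) (coherent Y).ι
      refine kernel_lift h3 U x ?_
      refine section_eq_zero ((pullbackCoh i).obj P).obj (U := i ⁻¹ᵁ U) _ fun z hz => ?_
      rw [h1] at hz
      exact hz.elim

end Resolution

/-! ### Torsion-free coherent covers -/

section TorsionFree

theorem exists_finite_affine_cover (Y : Scheme.{u}) [CompactSpace Y] :
    ∃ s : Finset Y.affineOpens, IsOpenCover fun V : s => V.1.1 := by
  obtain ⟨s, hs⟩ := isCompact_univ.elim_finite_subcover
    (fun V : Y.affineOpens => (V.1 : Set Y)) (fun V => V.1.2) (by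
      intro x _
      have h : x ∈ (⨆ V : Y.affineOpens, V.1 : Y.Opens) := by
        rw [iSup_affineOpens_eq_top]
        trivial
      obtain ⟨V, hV⟩ := Opens.mem_iSup.mp h
      exact Set.mem_iUnion.mpr ⟨V, hV⟩)
  refine ⟨s, eq_top_iff.mpr fun x _ => ?_⟩
  obtain ⟨V, hV, hx⟩ := Set.mem_iUnion₂.mp (hs (Set.mem_univ x))
  exact Opens.mem_iSup.mpr ⟨⟨V, hV⟩, hx⟩

variable {Y : Scheme.{u}} [IsLocallyNoetherian Y]

/-- Every section of a coherent sheaf over an affine open subset lies in the image of a coherent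
sheaf on which a given regular function acts injectively. -/
theorem exists_mono_mulCoh_of_section [CompactSpace Y] (σ : Γ(Y, ⊤))
    (hσ : ∀ (V : Y.Opens), IsAffineOpen V → ∀ x : Γ(Y, V), resGlobal σ V * x = 0 → x = 0)
    (E : Coh Y) (U : Y.Opens) [IsAffineHom U.ι] (t : Γ(E.obj, U)) :
    ∃ (F : Coh Y) (p : F ⟶ E), Mono ((mulCoh σ).app F) ∧ ∃ x, p.hom.app U x = t := by
  obtain ⟨P, p, q, hP, hq, hpq, y, hy⟩ := exists_extension E.property U t
  obtain ⟨J, hJ, hsub⟩ := exists_subsheaf U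
  obtain ⟨s, hs⟩ := exists_finite_affine_cover Y
  let N (V : Y.Opens) : Submodule Γ(Y, V) Γ(P, V) := LinearMap.ker (appLinear p V)
  -- An element killed by `p` has image under `q` vanishing on `U`, hence on the basic open subset
  -- of each `a` in `J`. Quasi-coherence then gives a power of `a` killing the image under `q`. As
  -- `p` and `q` are jointly injective, that power kills the element, so Artin–Rees applies.
  have hn (V : Y.affineOpens) : ∃ n₀ : ℕ, ∀ n ≥ n₀, J.ideal V ^ n • ⊤ ⊓ N V.1 = ⊥ := by
    have : IsNoetherianRing Γ(Y, V.1) := IsLocallyNoetherian.component_noetherian V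
    have := hP.2 V.1 V.2
    refine exists_forall_pow_smul_inf_eq_bot (J.ideal V) (N V.1) fun a ha x hx => ?_
    have hx' : p.app V.1 x = 0 := hx
    have h1 := hq V.1 x hx'
    have h2 : E.obj.presheaf.map (homOfLE (Y.basicOpen_le a)).op (q.app V.1 x) = 0 := by
      rw [← res_res E.obj (inf_le_left : V.1 ⊓ U ≤ V.1) (le_inf (Y.basicOpen_le a) (hJ V a ha)), h1,
        map_zero]
    obtain ⟨c, hc⟩ := ((isQuasicoherent_iff E.obj).mp E.property.1 V.1 V.2 a).2 _ h2
    refine ⟨c, hpq V.1 _ ?_ ?_⟩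
    · rw [Scheme.Modules.Hom.app_smul, hx', smul_zero]
    · rw [Scheme.Modules.Hom.app_smul, hc]
  choose n₀ hn₀ using hn
  -- Compactness gives one exponent valid on a whole affine cover.
  obtain ⟨Q, k, hk, hkJ, hkU⟩ := hsub (s.sup n₀) ⟨P, hP⟩
  refine ⟨Q, k ≫ ObjectProperty.homMk q, ?_, ?_⟩
  -- If `σ` kills `x`, it kills the function `p (k x)`, which is therefore zero. So `k x` lies in
  -- the intersection that Artin–Rees made trivial.
  · refine mono_mulCoh_of_injective σ Q _ (fun V => V.1.2) hs fun V x hx => hk V.1.1 ?_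
    rw [map_zero, ← Submodule.mem_bot Γ(Y, V.1.1), ← hn₀ V.1 _ (Finset.le_sup V.2)]
    refine ⟨hkJ V.1 x, ?_⟩
    have h1 := congrArg (fun z => p.app V.1.1 (k.hom.app V.1.1 z)) hx
    simp only [Scheme.Modules.Hom.app_smul, map_zero] at h1
    exact hσ V.1.1 V.1.2 _ h1
  · obtain ⟨x, hx⟩ := hkU y
    exact ⟨x, (congrArg (q.app U) hx).trans hy⟩

/-- Every coherent sheaf is a quotient of a coherent sheaf on which a given regular function acts
injectively. -/
theorem exists_mono_mulCoh_epi [CompactSpace Y]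
    (haff : ∀ U : Y.Opens, IsAffineOpen U → IsAffineHom U.ι) (σ : Γ(Y, ⊤))
    (hσ : ∀ (V : Y.Opens), IsAffineOpen V → ∀ x : Γ(Y, V), resGlobal σ V * x = 0 → x = 0)
    (E : Coh Y) : ∃ (F : Coh Y) (p : F ⟶ E), Mono ((mulCoh σ).app F) ∧ Epi p := by
  obtain ⟨s, hs⟩ := exists_finite_affine_cover Y
  have hgen (V : s) : ∃ g : Finset Γ(E.obj, V.1.1), Submodule.span Γ(Y, V.1.1) (g : Set Γ(E.obj, V.1.1)) = ⊤ :=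
    (E.property.2 V.1.1 V.1.2).1
  choose g hg using hgen
  have hex (j : Σ V : s, g V) : ∃ (F : Coh Y) (p : F ⟶ E), Mono ((mulCoh σ).app F) ∧
      ∃ x, p.hom.app j.1.1.1 x = j.2.1 := by
    have := haff j.1.1.1 j.1.1.2
    exact exists_mono_mulCoh_of_section σ hσ E _ _
  choose F p hF x hx using hex
  have : HasFiniteBiproducts (Coh Y) := HasFiniteBiproducts.of_hasFiniteProducts
  -- There is one summand for each member of the finite cover and each generator of the sections of
  -- `E` over it.
  refine ⟨⨁ F, biproduct.desc p, ?_, ?_⟩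
  · refine Preadditive.mono_of_cancel_zero _ fun {G} a ha => ?_
    refine biproduct.hom_ext _ _ fun j => ?_
    have h1 : (mulCoh σ).app (⨁ F) ≫ biproduct.π F j = biproduct.π F j ≫ (mulCoh σ).app (F j) :=
      ((mulCoh σ).naturality (biproduct.π F j)).symm
    rw [zero_comp, ← cancel_mono ((mulCoh σ).app (F j)), zero_comp]
    refine (Category.assoc _ _ _).trans ((congrArg (a ≫ ·) h1.symm).trans ?_)
    exact (Category.assoc _ _ _).symm.trans ((congrArg (· ≫ _) ha).trans zero_comp)
  · refine Preadditive.epi_of_cancel_zero _ fun {G} a ha => ?_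
    apply (coherent Y).hom_ext
    refine hom_eq_zero_of_cover E.property.1 _ (fun V : s => V.1.1) (fun V => V.1.2) hs
      fun V y => ?_
    have h1 : Submodule.span Γ(Y, V.1.1) (g V : Set Γ(E.obj, V.1.1)) ≤
        LinearMap.ker (appLinear a.hom V.1.1) := by
      refine Submodule.span_le.mpr fun t ht => ?_
      have h2 : p ⟨V, t, ht⟩ ≫ a = 0 := by
        rw [← biproduct.ι_desc p ⟨V, t, ht⟩, Category.assoc, ha, comp_zero]
      have h3 : a.hom.app V.1.1 ((p ⟨V, t, ht⟩).hom.app V.1.1 (x ⟨V, t, ht⟩)) = 0 :=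
        congr(Scheme.Modules.Hom.app (InducedCategory.Hom.hom $h2) V.1.1 (x ⟨V, t, ht⟩))
      exact (congrArg _ (hx ⟨V, t, ht⟩)).symm.trans h3
    rw [hg V] at h1
    exact h1 (Submodule.mem_top (x := y))

end TorsionFree

/-! ### Base change of a principal closed subscheme -/

section PrincipalBaseChange

variable {A : CommRingCat.{u}} {Y : Scheme.{u}}

/-- The function on a scheme over `Spec A` given by an element of `A`. -/
noncomputable abbrev functionOf (g : Y ⟶ Spec A) (r : A) : Γ(Y, ⊤) :=
  g.app ⊤ ((Scheme.ΓSpecIso A).inv r)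

theorem functionOf_comp {X : Scheme.{u}} (h : X ⟶ Y) (g : Y ⟶ Spec A) (r : A) :
    functionOf (h ≫ g) r = h.app ⊤ (functionOf g r) :=
  congr($(Scheme.Hom.comp_app h g ⊤) ((Scheme.ΓSpecIso A).inv r))

theorem functionOf_comp_specMap {B : CommRingCat.{u}} (g : Y ⟶ Spec B) (φ : A ⟶ B) (r : A) :
    functionOf (g ≫ Spec.map φ) r = functionOf g (φ r) := by
  rw [functionOf_comp]
  exact congrArg (g.app ⊤) (ConcreteCategory.congr_hom (Scheme.ΓSpecIso_inv_naturality φ) r).symm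

theorem functionOf_specMap {B : CommRingCat.{u}} (φ : A ⟶ B) (r : A) :
    functionOf (Spec.map φ) r = (Scheme.ΓSpecIso B).inv (φ r) :=
  (ConcreteCategory.congr_hom (Scheme.ΓSpecIso_inv_naturality φ) r).symm

theorem ΓSpecIso_inv_eq_appLE {V : Y.Opens} (hV : IsAffineOpen V) :
    (Scheme.ΓSpecIso Γ(Y, V)).inv = hV.fromSpec.appLE V ⊤ hV.fromSpec_preimage_self.ge := by
  rw [Scheme.Hom.appLE, hV.fromSpec_app_self, Category.assoc, ← Functor.map_comp,
    ← op_comp, Subsingleton.elim (_ ≫ _) (𝟙 _)]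
  simp

theorem fromSpec_app_top {V : Y.Opens} (hV : IsAffineOpen V) (σ : Γ(Y, ⊤)) :
    hV.fromSpec.app ⊤ σ = (Scheme.ΓSpecIso Γ(Y, V)).inv (resGlobal σ V) := by
  have h := ConcreteCategory.congr_hom (hV.fromSpec.map_appLE hV.fromSpec_preimage_self.ge
    (homOfLE (le_top : V ≤ ⊤)).op) σ
  rw [← ΓSpecIso_inv_eq_appLE] at h
  refine Eq.trans ?_ h.symm
  exact congr($(hV.fromSpec.appLE_eq_app (U := ⊤)) σ).symm

/-- A regular element acts injectively on functions on a flat scheme. -/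
theorem eq_zero_of_resGlobal_functionOf_mul (g : Y ⟶ Spec A) [Flat g] {r : A} (hr : IsRegular r)
    {V : Y.Opens} (hV : IsAffineOpen V) (x : Γ(Y, V))
    (hx : resGlobal (functionOf g r) V * x = 0) : x = 0 := by
  have h1 := g.flat_appLE (isAffineOpen_top (Spec A)) hV le_top
  let _ : Algebra Γ(Spec A, ⊤) Γ(Y, V) := (g.appLE ⊤ V le_top).hom.toAlgebra
  have : Module.Flat Γ(Spec A, ⊤) Γ(Y, V) := h1
  have h2 : IsRegular ((Scheme.ΓSpecIso A).inv r) := by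
    let e := (Scheme.ΓSpecIso A).symm.commRingCatIsoToRingEquiv
    refine isLeftRegular_iff_isRegular.mp fun a b hab => ?_
    refine e.symm.injective (hr.1 (e.injective ?_))
    change e (r * e.symm a) = e (r * e.symm b)
    rw [map_mul, map_mul, e.apply_symm_apply, e.apply_symm_apply]
    exact hab
  exact (Module.Flat.isSMulRegular_of_isRegular (M := Γ(Y, V)) h2).right_eq_zero_of_smul hx

variable {Z : Scheme.{u}} {i : Z ⟶ Y} {g : Y ⟶ Spec A} {r : A}
  {q : Z ⟶ Spec (.of (A ⧸ Ideal.span {r}))}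

theorem app_functionOf_eq_zero
    (h : i ≫ g = q ≫ Spec.map (CommRingCat.ofHom (Ideal.Quotient.mk (Ideal.span {r})))) :
    i.app ⊤ (functionOf g r) = 0 := by
  rw [← functionOf_comp, h, functionOf_comp_specMap]
  have : CommRingCat.ofHom (Ideal.Quotient.mk (Ideal.span {r})) r = 0 :=
    Ideal.Quotient.eq_zero_iff_mem.mpr (Ideal.mem_span_singleton_self r)
  rw [this, functionOf, map_zero]
  exact map_zero (q.app ⊤).hom

/-- The ideal of the base change of a principal closed subscheme is principal. -/
theorem ker_app_le_span
    (h : IsPullback i q g (Spec.map (CommRingCat.ofHom (Ideal.Quotient.mk (Ideal.span {r})))))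
    {V : Y.Opens} (hV : IsAffineOpen V) :
    RingHom.ker (i.app V).hom ≤ Ideal.span {resGlobal (functionOf g r) V} := by
  let I : Ideal Γ(Y, V) := Ideal.span {resGlobal (functionOf g r) V}
  let κ : Γ(Y, V) ⟶ CommRingCat.of (Γ(Y, V) ⧸ I) := CommRingCat.ofHom (Ideal.Quotient.mk I)
  -- The element `r` vanishes on this affine scheme over `Y`, so `ψ` factors through `Z` by the
  -- universal property of the pullback. A function that dies on `Z` therefore dies in `Γ(Y, V) ⧸
  -- I`.
  let ψ : Spec (.of (Γ(Y, V) ⧸ I)) ⟶ Y := Spec.map κ ≫ hV.fromSpec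
  obtain ⟨ρ, hρ⟩ := Spec.map_surjective (ψ ≫ g)
  have h1 : ρ r = 0 := by
    have h2 : functionOf (ψ ≫ g) r = 0 := by
      rw [functionOf_comp]
      have h3 : ψ.app ⊤ (functionOf g r) = (Spec.map κ).app ⊤ (hV.fromSpec.app ⊤ (functionOf g r)) :=
        congr($(Scheme.Hom.comp_app (Spec.map κ) hV.fromSpec ⊤) (functionOf g r))
      rw [h3, fromSpec_app_top]
      refine (functionOf_specMap κ _).trans ?_
      have h4 : κ (resGlobal (functionOf g r) V) = 0 :=
        Ideal.Quotient.eq_zero_iff_mem.mpr (Ideal.mem_span_singleton_self _)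
      rw [h4, map_zero]
    rw [← hρ, functionOf_specMap] at h2
    exact (map_eq_zero_iff _ (ConcreteCategory.bijective_of_isIso (Scheme.ΓSpecIso _).inv).1).mp h2
  let l : CommRingCat.of (A ⧸ Ideal.span {r}) ⟶ CommRingCat.of (Γ(Y, V) ⧸ I) :=
    CommRingCat.ofHom (Ideal.Quotient.lift _ ρ.hom fun a ha => by
      obtain ⟨b, rfl⟩ := Ideal.mem_span_singleton'.mp ha
      exact (map_mul ρ.hom b r).trans ((congrArg (_ * ·) h1).trans (mul_zero _)))
  have hl : CommRingCat.ofHom (Ideal.Quotient.mk (Ideal.span {r})) ≫ l = ρ := by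
    ext a
    rfl
  have hw : ψ ≫ g = Spec.map l ≫
      Spec.map (CommRingCat.ofHom (Ideal.Quotient.mk (Ideal.span {r}))) := by
    rw [← Spec.map_comp, hl, hρ]
  have hψ : h.lift ψ (Spec.map l) hw ≫ i = ψ := h.lift_fst _ _ _
  intro x hx
  have hVψ : ⊤ ≤ ψ ⁻¹ᵁ V := by
    rw [Scheme.Hom.comp_preimage, hV.fromSpec_preimage_self]
    exact le_rfl
  have h5 : ψ.appLE V ⊤ hVψ x = (Scheme.ΓSpecIso _).inv (κ x) := by
    have h6 := (Spec.map κ).appLE_comp_appLE hV.fromSpec V ⊤ ⊤ hV.fromSpec_preimage_self.ge le_rfl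
    rw [← ΓSpecIso_inv_eq_appLE] at h6
    rw [← ConcreteCategory.congr_hom h6 x]
    refine Eq.trans ?_ (functionOf_specMap κ x)
    exact congr($((Spec.map κ).appLE_eq_app (U := ⊤)) ((Scheme.ΓSpecIso _).inv x))
  have h7 : ψ.appLE V ⊤ hVψ x = 0 := by
    have h8 (χ : Spec (.of (Γ(Y, V) ⧸ I)) ⟶ Z) (hχ : ⊤ ≤ (χ ≫ i) ⁻¹ᵁ V) :
        (χ ≫ i).appLE V ⊤ hχ x = 0 := by
      rw [Scheme.Hom.comp_appLE, ConcreteCategory.comp_apply]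
      exact (congrArg _ hx).trans (map_zero (Scheme.Hom.appLE _ _ _ _).hom)
    generalize h.lift ψ (Spec.map l) hw = χ at hψ
    clear_value ψ
    subst hψ
    exact h8 χ hVψ
  rw [h5] at h7
  exact Ideal.Quotient.eq_zero_iff_mem.mp
    ((map_eq_zero_iff _ (ConcreteCategory.bijective_of_isIso (Scheme.ΓSpecIso _).inv).1).mp h7)

end PrincipalBaseChange

/-! ### The thickenings of a projective three-fold -/

section Threefold

variable {k : Type u} [Field k] {X : Scheme.{u}} (f : X ⟶ Spec (.of k))

attribute [local instance] MvPolynomial.gradedAlgebra in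
-- The polynomial ring is of finite type over `k`, hence over its degree-zero part. This makes the
-- structure morphism of projective space separated and quasi-compact, and a closed immersion
-- preserves both properties.
theorem isSeparated_and_quasiCompact [h : IsSmoothProjectiveThreefold f] :
    IsSeparated f ∧ QuasiCompact f := by
  obtain ⟨n, i, hi, rfl⟩ := h.projective
  have h1 : (algebraMap k (MvPolynomial (Fin (n + 1)) k)).FiniteType :=
    RingHom.finiteType_algebraMap.mpr inferInstance
  have : Algebra.FiniteType (MvPolynomial.homogeneousSubmodule (Fin (n + 1)) k 0)
      (MvPolynomial (Fin (n + 1)) k) :=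
    RingHom.finiteType_algebraMap.mp (RingHom.FiniteType.of_comp_finiteType
      (f := algebraMap k (MvPolynomial.homogeneousSubmodule (Fin (n + 1)) k 0)) h1)
  exact ⟨inferInstance, inferInstance⟩

instance [IsSmoothProjectiveThreefold f] : IsSeparated f := (isSeparated_and_quasiCompact f).1

instance [IsSmoothProjectiveThreefold f] : QuasiCompact f := (isSeparated_and_quasiCompact f).2

variable {R : Type u} [CommRing R] [Algebra k R] (π : R) (m : ℕ)

instance [IsSmoothProjectiveThreefold f] : CompactSpace (baseChange f R) :=
  (quasiCompact_iff_compactSpace (f := pullback.snd f (Spec.map (CommRingCat.ofHom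
    (algebraMap k R))))).mp inferInstance

/-- Cancellation for pasted pullback squares: `X_m` and `X_R` are both base changes of `X`. -/
theorem isPullback_thickeningι : IsPullback (thickeningι f π m) (pullback.snd _ _)
    (pullback.snd _ _) (Spec.map (CommRingCat.ofHom (Ideal.Quotient.mk (Ideal.span {π ^ m})))) := by
  have h := IsPullback.of_hasPullback f (Spec.map (CommRingCat.ofHom (algebraMap k R)))
  have e : Spec.map (CommRingCat.ofHom (algebraMap k (R ⧸ Ideal.span {π ^ m}))) =
      Spec.map (CommRingCat.ofHom (Ideal.Quotient.mk (Ideal.span {π ^ m}))) ≫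
        Spec.map (CommRingCat.ofHom (algebraMap k R)) := by
    rw [← Spec.map_comp, ← CommRingCat.ofHom_comp]
  refine IsPullback.of_right (h₁₂ := pullback.fst _ _) ?_ (pullback.lift_snd _ _ _) h
  have h1 : thickeningι f π m ≫ pullback.fst _ _ = pullback.fst _ _ := pullback.lift_fst _ _ _
  rw [h1, ← e]
  exact IsPullback.of_hasPullback f _

/-- Flatness over `R` makes `π ^ m` act injectively on functions, and the pullback square makes it
generate the ideal of `X_m`. Compactness and separatedness feed the construction of torsion-free
covers. -/
theorem isDivisor_thickeningι [IsSmoothProjectiveThreefold f] [IsNoetherianRing R]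
    (hπ : IsRegular π) : IsDivisor (cohAdjunction (thickeningι f π m))
      (mulCoh (functionOf (A := .of R)
        (pullback.snd f (Spec.map (CommRingCat.ofHom (algebraMap k R)))) (π ^ m))) := by
  have h := isPullback_thickeningι f π m
  refine isDivisor_mulCoh _ _ (app_functionOf_eq_zero (A := .of R) h.w)
    (fun V hV => ker_app_le_span (A := .of R) h hV)
    (exists_mono_mulCoh_epi (fun U hU => ?_) _ fun V hV x hx =>
      eq_zero_of_resGlobal_functionOf_mul (A := .of R) _ (hπ.pow m) hV x hx)
  -- The composite from `U` to `Spec R` is a morphism of affine schemes, hence affine. As `X_R` is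
  -- separated over `Spec R`, the inclusion of `U` is affine too.
  have : IsAffine U := hU
  exact IsAffineHom.of_comp U.ι (pullback.snd f (Spec.map (CommRingCat.ofHom (algebraMap k R))))

end Threefold

end PTHeart

open PTHeart
theorem corollary5p7 {k : Type u} [Field k] [IsAlgClosed k] [CharZero k]
    {X : Scheme.{u}} (f : X ⟶ Spec (.of k)) [IsSmoothProjectiveThreefold f]
    {R : Type u} [CommRing R] [IsDomain R] [IsDiscreteValuationRing R] [Algebra k R]
    (π : R) (hπ : Irreducible π) (m : ℕ) (hm : 1 ≤ m)
    [HasDerivedCategory.{w} (Coh (baseChange f R))]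
    [HasDerivedCategory.{w} (Coh (thickening f π m))] :
    (pullbackComplex (thickeningι f π m)).HasLeftDerivedFunctor (cohQuasiIso (baseChange f R)) ∧
    ∀ (Lι : DerivedCategory (Coh (baseChange f R)) ⥤ DerivedCategory (Coh (thickening f π m)))
      (α : DerivedCategory.Q ⋙ Lι ⟶ pullbackComplex (thickeningι f π m))
      [Lι.IsLeftDerivedFunctor α (cohQuasiIso (baseChange f R))]
      (F : DerivedCategory (Coh (thickening f π m))),
      tiltedHeart (thickening f π m) F →
      ∃ (a : F⟦(1 : ℤ)⟧ ⟶ Lι.obj ((pushforwardCoh (thickeningι f π m)).mapDerivedCategory.obj F))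
        (b : Lι.obj ((pushforwardCoh (thickeningι f π m)).mapDerivedCategory.obj F) ⟶ F)
        (c : F ⟶ F⟦(2 : ℤ)⟧),
        Pretriangulated.Triangle.mk a b (c ≫ (shiftFunctorAdd' _ (1 : ℤ) 1 2 rfl).hom.app F) ∈
          Pretriangulated.distinguishedTriangles := by
  -- A uniformiser is nonzero in a domain, hence regular.
  obtain ⟨h1, h2⟩ := (isDivisor_thickeningι f π m
    (IsRegular.of_ne_zero hπ.ne_zero)).hasLeftDerivedFunctor_and_exists_triangle
  exact ⟨h1, fun Lι α _ F _ => h2 Lι α F⟩
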